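/- Let $\Phi$ be the root system of type $E_8$, $W=\mathrm{Weyl}(E_8)$ its Weyl group, $W'$ the commutator subgroup of $W$ and $Z(W)=\{\pm1\}$ its centre (note $Z(W)\le W'$). Let $\Phi_0\subset\Phi$ be a sub root system of type $A_8$, and let $W_0\le W$ be its Weyl group. Then $W_0\cong \mathrm{Sym}_9$, $Z(W)\cap W_0=1$, and: (i) $Z(W)\times W_0$ is a maximal subgroup of $W$; (ii) $Z(W)\times W_0'$ is a maximal subgroup of $W'$. Moreover, the triality twist of (ii) holds. For an automorphism $\tau$ of $W'/Z(W)\;(\cong\Omega^+(8,2))$, let $K_\tau\le W'$ be the full preimage in $W'$ of $\tau\big((Z(W)\times W_0')/Z(W)\big)$. Then there is an automorphism $\tau$ of order $3$, not induced by conjugation by an element of $W$, for which $K_\tau$ is the double cover $2\cdot\mathrm{Alt}_9$ (that is, $K_\tau$ is perfect, has centre of order $2$, and its central quotient is isomorphic to $\mathrm{Alt}_9$); and for every automorphism $\tau$ of $W'/Z(W)$ that is not induced by conjugation by an element of $W$, the group $K_\tau$ is a maximal subgroup of $W'$. -/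

import Mathlib

/-- The rational space `ℚ⁸`, with the standard bilinear form `v ⬝ᵥ w`, that contains the
`E₈`-lattice. -/
abbrev E8Space : Type := Fin 8 → ℚ

/-- The root system `Φ` of type `E₈`: the vectors of norm `2` in the `E₈`-lattice, which consists of
the vectors with even coordinate sum whose coordinates are all in `ℤ` or all in `ℤ + 1/2`. -/
def e8Roots : Set E8Space :=
  {x | ((∀ i, ∃ n : ℤ, x i = n) ∨ (∀ i, ∃ n : ℤ, x i = n + 1 / 2)) ∧
    (∃ n : ℤ, ∑ i, x i = 2 * n) ∧ x ⬝ᵥ x = 2}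

/-- `g` is the reflection at the vector `α` (which will have norm `2`). -/
def IsRootReflection (g : E8Space ≃ₗ[ℚ] E8Space) (α : E8Space) : Prop :=
  ∀ v, g v = v - (v ⬝ᵥ α) • α

/-- `W = Weyl(E₈)`, the group generated by the reflections at the roots of `E₈`. -/
def weylE8 : Subgroup (E8Space ≃ₗ[ℚ] E8Space) :=
  Subgroup.closure {g | ∃ α ∈ e8Roots, IsRootReflection g α}

/-- `Φ₀` is a sub root system of type `A₈` of `Φ`: it consists of roots, is closed under its own
reflections, and has a base with Cartan matrix of type `A₈` (the roots have norm `2`, so the Cartan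
matrix is the Gram matrix; it is invertible, so the base is linearly independent). -/
structure IsA8Subsystem (Φ₀ : Set E8Space) : Prop where
  subset_roots : Φ₀ ⊆ e8Roots
  reflection_mem : ∀ α ∈ Φ₀, ∀ β ∈ Φ₀, β - (β ⬝ᵥ α) • α ∈ Φ₀
  exists_base : ∃ δ : Fin 8 → E8Space,
    (∀ i, δ i ∈ Φ₀) ∧
    (∀ i j, δ i ⬝ᵥ δ j = (CartanMatrix.A 8 i j : ℚ)) ∧
    (∀ β ∈ Φ₀, ∃ c : Fin 8 → ℤ,
      β = ∑ i, c i • δ i ∧ ((∀ i, 0 ≤ c i) ∨ (∀ i, c i ≤ 0)))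

/-- The Weyl group of a set `Φ₀` of roots, as a subgroup of `W`. -/
def weylSub (Φ₀ : Set E8Space) : Subgroup weylE8 :=
  Subgroup.closure {g | ∃ α ∈ Φ₀, IsRootReflection (g : E8Space ≃ₗ[ℚ] E8Space) α}

/-- The group `W' / Z(W)` (isomorphic to `Ω⁺(8,2)`). -/
abbrev WeylE8Omega : Type :=
  ↥(commutator weylE8) ⧸ (Subgroup.center weylE8).subgroupOf (commutator weylE8)

/-- The quotient map `W' → W' / Z(W)`. -/
def toOmega : ↥(commutator weylE8) →* WeylE8Omega :=
  QuotientGroup.mk' _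

/-- The automorphism `τ` of `W' / Z(W)` is of triality type: it is not induced by conjugation by
an element of `W`, that is, it does not lie in the group generated by the inner automorphisms and
the graph automorphism coming from a reflection. -/
def IsTrialityType (τ : MulAut WeylE8Omega) : Prop :=
  ¬ ∃ w : weylE8, ∀ x : ↥(commutator weylE8), τ (toOmega x) = toOmega (MulAut.conjNormal w x)

/-- The twist by `τ` of a subgroup `H` of `W'`: the full preimage in `W'` of the `τ`-image of
`H Z(W) / Z(W)`, as a subgroup of `W`. -/
def twist (τ : MulAut WeylE8Omega) (H : Subgroup weylE8) : Subgroup weylE8 :=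
  ((((H.subgroupOf (commutator weylE8)).map toOmega).map τ.toMonoidHom).comap toOmega).map
    (commutator weylE8).subtype

/-- `K ≅ 2·Alt_n` (the non-split double cover, for `n ≥ 5`): `K` is perfect, its centre has order
`2`, and the central quotient is `Alt_n`. -/
structure IsDoubleCoverAlt (n : ℕ) (K : Type*) [Group K] : Prop where
  perfect : commutator K = ⊤
  card_center : Nat.card (Subgroup.center K) = 2
  quotient : Nonempty (K ⧸ Subgroup.center K ≃* alternatingGroup (Fin n))

/-! A base of type `A₈` determines nine vectors `ε i` with sum zero, the vertices of a regular
simplex, such that `Φ₀` consists of the differences `ε i - ε j`; these are the `diffs` of an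
`IsFrame`. The reflection at `ε i - ε j` transposes two vertices, so `W₀` is `Sym₉`. The remaining
roots are the vectors `±(ε i + ε j + ε k)` (`root_cases`, `tri_mem`), and any one of them together
with `Φ₀` yields all roots under reflection (`roots_subset`).

Maximality: `Z(W) × W₀` is the stabiliser of `Φ₀` in `W`. A larger subgroup contains an element that
moves a difference to some `±(ε i + ε j + ε k)`, hence the reflection there, hence all reflections.
In `W'`, which is the kernel of the determinant, single reflections are not available. They are
replaced by the relation `rf a * rf b ∈ M`, which is compatible with reflection
(`rf_mul_rf_reflect`); `exists_root_rel` links a non-difference to a difference.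

Triality: a para-octonion product `mu` on `ℚ⁸` has a cyclic trilinear form `mu x y ⬝ᵥ z`. The
triples in `W'` preserving it are permuted cyclically by `rotate`. Every element of `W'` is the
first entry of a triple (`exists_triple`), and the other entries are determined up to sign, so
`rotate` descends to an automorphism `τ` of `W'/Z(W)` with `τ³ = 1`. The product of two reflections
has the spin-type companion `v ↦ mu (mu b v) a`. By Clifford relations, the commuting double
transpositions `(01)(23)` and `(02)(13)` have companions that anticommute. This one fact shows that
`τ` is not induced by `W`, and that `-1` is a commutator in the twisted group, which is therefore a
perfect extension of `Alt₉`. Maximality of twists follows since an automorphism of `W'/Z(W)`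
preserves the inclusion order of the subgroups above `Z(W)`. -/

open Equiv
open scoped commutatorElement

/-! ### The lattice, root reflections and the determinant. -/

namespace E8

/-- The `E₈`-lattice. -/
def lattice : AddSubgroup E8Space where
  carrier := {x | ((∀ i, ∃ n : ℤ, x i = n) ∨ (∀ i, ∃ n : ℤ, x i = n + 1 / 2)) ∧
    (∃ n : ℤ, ∑ i, x i = 2 * n)}
  zero_mem' := ⟨Or.inl fun _ => ⟨0, by simp⟩, 0, by simp⟩
  add_mem' := by
    rintro x y ⟨hx, m, hm⟩ ⟨hy, n, hn⟩
    refine ⟨?_, m + n, by simp [Finset.sum_add_distrib, hm, hn]; ring⟩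
    rcases hx with hx | hx <;> rcases hy with hy | hy
    · exact Or.inl fun i => by
        obtain ⟨a, ha⟩ := hx i; obtain ⟨b, hb⟩ := hy i
        exact ⟨a + b, by simp [ha, hb]⟩
    · exact Or.inr fun i => by
        obtain ⟨a, ha⟩ := hx i; obtain ⟨b, hb⟩ := hy i
        exact ⟨a + b, by simp [ha, hb]; ring⟩
    · exact Or.inr fun i => by
        obtain ⟨a, ha⟩ := hx i; obtain ⟨b, hb⟩ := hy i
        exact ⟨a + b, by simp [ha, hb]; ring⟩
    · exact Or.inl fun i => by
        obtain ⟨a, ha⟩ := hx i; obtain ⟨b, hb⟩ := hy i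
        exact ⟨a + b + 1, by simp [ha, hb]; ring⟩
  neg_mem' := by
    rintro x ⟨hx, m, hm⟩
    refine ⟨?_, -m, by simp [hm]⟩
    rcases hx with hx | hx
    · exact Or.inl fun i => by
        obtain ⟨a, ha⟩ := hx i
        exact ⟨-a, by simp [ha]⟩
    · exact Or.inr fun i => by
        obtain ⟨a, ha⟩ := hx i
        exact ⟨-a - 1, by simp [ha]; ring⟩

theorem mem_roots {x : E8Space} : x ∈ e8Roots ↔ x ∈ lattice ∧ x ⬝ᵥ x = 2 :=
  ⟨fun h => ⟨⟨h.1, h.2.1⟩, h.2.2⟩, fun h => ⟨h.1.1, h.1.2, h.2⟩⟩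

theorem int_dot_half {x y : E8Space} (hx : ∀ i, ∃ n : ℤ, x i = n) (hs : ∃ n : ℤ, ∑ i, x i = 2 * n)
    (hy : ∀ i, ∃ n : ℤ, y i = n + 1 / 2) : ∃ n : ℤ, x ⬝ᵥ y = n := by
  choose a ha using hx
  choose b hb using hy
  obtain ⟨s, hs⟩ := hs
  refine ⟨∑ i, a i * b i + s, ?_⟩
  have : x ⬝ᵥ y = ∑ i, (a i * b i + x i * (1 / 2) : ℚ) := by
    unfold dotProduct
    exact Finset.sum_congr rfl fun i _ => by rw [hb, mul_add, ha]
  rw [this, Finset.sum_add_distrib, ← Finset.sum_mul, hs]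
  push_cast
  ring

theorem dot_int {x y : E8Space} (hx : x ∈ lattice) (hy : y ∈ lattice) :
    ∃ n : ℤ, x ⬝ᵥ y = n := by
  obtain ⟨hx | hx, hsx⟩ := hx <;> obtain ⟨hy | hy, hsy⟩ := hy
  · choose a ha using hx
    choose b hb using hy
    exact ⟨∑ i, a i * b i, by simp [dotProduct, ha, hb]⟩
  · exact int_dot_half hx hsx hy
  · rw [dotProduct_comm]
    exact int_dot_half hy hsy hx
  · choose a ha using hx
    choose b hb using hy
    obtain ⟨s, hs⟩ := hsx
    obtain ⟨t, ht⟩ := hsy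
    refine ⟨∑ i, a i * b i + s + t - 2, ?_⟩
    have : x ⬝ᵥ y = ∑ i, (a i * b i + x i * (1 / 2) + y i * (1 / 2) - 1 / 4 : ℚ) := by
      unfold dotProduct
      exact Finset.sum_congr rfl fun i _ => by rw [ha, hb]; ring
    rw [this, Finset.sum_sub_distrib, Finset.sum_add_distrib, Finset.sum_add_distrib,
      ← Finset.sum_mul, ← Finset.sum_mul, hs, ht]
    push_cast
    simp
    ring

theorem reflection_mem_roots {a b : E8Space} (ha : a ∈ e8Roots) (hb : b ∈ e8Roots) :
    b - (b ⬝ᵥ a) • a ∈ e8Roots := by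
  rw [mem_roots] at *
  obtain ⟨n, hn⟩ := dot_int hb.1 ha.1
  refine ⟨?_, ?_⟩
  · have : (b ⬝ᵥ a) • a = n • a := by rw [hn, Int.cast_smul_eq_zsmul]
    rw [this]
    exact lattice.sub_mem hb.1 (lattice.zsmul_mem ha.1 n)
  · simp only [sub_dotProduct, dotProduct_sub, smul_dotProduct, dotProduct_smul, ha.2, hb.2,
      smul_eq_mul, dotProduct_comm a b]
    ring

/-- The linear functional `v ↦ v ⬝ᵥ a`. -/
def dotMap (a : E8Space) : E8Space →ₗ[ℚ] ℚ where
  toFun v := v ⬝ᵥ a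
  map_add' u v := add_dotProduct u v a
  map_smul' c v := smul_dotProduct c v a

/-- The linear map `v ↦ v - (v ⬝ᵥ a) • a`. -/
def reflMap (a : E8Space) : E8Space →ₗ[ℚ] E8Space :=
  LinearMap.id - (dotMap a).smulRight a

theorem reflMap_apply (a v : E8Space) : reflMap a v = v - (v ⬝ᵥ a) • a := rfl

theorem reflMap_reflMap {a : E8Space} (ha : a ⬝ᵥ a = 2) (v : E8Space) :
    reflMap a (reflMap a v) = v := by
  simp only [reflMap_apply, sub_dotProduct, smul_dotProduct, ha, smul_eq_mul]
  module

/-- The reflection at a root, as an element of the Weyl group. -/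
def rf (a : e8Roots) : weylE8 :=
  ⟨LinearEquiv.ofInvolutive (reflMap a) (reflMap_reflMap a.2.2.2),
    Subgroup.subset_closure ⟨a, a.2, fun _ => rfl⟩⟩

theorem rf_apply (a : e8Roots) (v : E8Space) : (rf a).1 v = v - (v ⬝ᵥ a) • (a : E8Space) := rfl

theorem ext_weyl {w w' : weylE8} (h : ∀ v, w.1 v = w'.1 v) : w = w' :=
  Subtype.ext (LinearEquiv.ext h)

@[simp] theorem rf_mul_self (a : e8Roots) : rf a * rf a = 1 :=
  ext_weyl (reflMap_reflMap a.2.2.2)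

@[simp] theorem rf_inv (a : e8Roots) : (rf a)⁻¹ = rf a := inv_eq_of_mul_eq_one_left (rf_mul_self a)

theorem rf_eq {a : e8Roots} {w : weylE8} (h : IsRootReflection w.1 a) : w = rf a :=
  ext_weyl h

theorem weyl_induction {p : weylE8 → Prop} (h1 : p 1) (hmul : ∀ a w, p w → p (rf a * w))
    (w : weylE8) : p w := by
  have key : ∀ g (hg : g ∈ weylE8), p ⟨g, hg⟩ := by
    intro g hg
    refine Subgroup.closure_induction_left (p := fun g hg => p ⟨g, hg⟩) h1 ?_ ?_ hg
    · rintro x ⟨a, ha, hx⟩ y hy h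
      have : (⟨x, Subgroup.subset_closure ⟨a, ha, hx⟩⟩ : weylE8) = rf ⟨a, ha⟩ := rf_eq hx
      have := hmul ⟨a, ha⟩ _ h
      rwa [← ‹_ = rf _›] at this
    · rintro x ⟨a, ha, hx⟩ y hy h
      have e : (⟨x, Subgroup.subset_closure ⟨a, ha, hx⟩⟩ : weylE8)⁻¹ = rf ⟨a, ha⟩ := by
        rw [rf_eq (w := ⟨x, Subgroup.subset_closure ⟨a, ha, hx⟩⟩) (a := ⟨a, ha⟩) hx, rf_inv]
      have := hmul ⟨a, ha⟩ _ h
      rwa [← e] at this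
  exact key w.1 w.2

theorem dot_map (w : weylE8) (u v : E8Space) : w.1 u ⬝ᵥ w.1 v = u ⬝ᵥ v := by
  induction w using weyl_induction generalizing u v with
  | h1 => rfl
  | hmul a w ih =>
    change (rf a).1 (w.1 u) ⬝ᵥ (rf a).1 (w.1 v) = _
    simp only [rf_apply, sub_dotProduct, dotProduct_sub, smul_dotProduct, dotProduct_smul,
      a.2.2.2, smul_eq_mul, dotProduct_comm (a : E8Space), ih]
    ring

theorem map_mem_roots (w : weylE8) {b : E8Space} (hb : b ∈ e8Roots) : w.1 b ∈ e8Roots := by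
  induction w using weyl_induction with
  | h1 => exact hb
  | hmul a w ih => exact reflection_mem_roots a.2 ih

/-- The action of the Weyl group on the roots. -/
def mapRoot (w : weylE8) (a : e8Roots) : e8Roots := ⟨w.1 a, map_mem_roots w a.2⟩

theorem mul_apply (w w' : weylE8) (v : E8Space) : (w * w').1 v = w.1 (w'.1 v) := rfl

theorem apply_inv_apply (w : weylE8) (v : E8Space) : w.1 (w⁻¹.1 v) = v := by
  rw [← mul_apply, mul_inv_cancel]; rfl

theorem conj_rf (w : weylE8) (a : e8Roots) : w * rf a * w⁻¹ = rf (mapRoot w a) := by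
  refine ext_weyl fun v => ?_
  rw [mul_apply, mul_apply, rf_apply, rf_apply, map_sub, map_smul, apply_inv_apply]
  congr 2
  rw [← dot_map w, apply_inv_apply]
  rfl

theorem rf_neg {a b : e8Roots} (h : (b : E8Space) = -a) : rf b = rf a :=
  ext_weyl fun v => by simp [rf_apply, h]

/-- The determinant, as a character of the Weyl group. -/
noncomputable def sgn : weylE8 →* ℚˣ := LinearEquiv.det.comp weylE8.subtype

theorem sgn_rf (a : e8Roots) : sgn (rf a) = -1 := by
  have h : ((LinearEquiv.det (rf a).1 : ℚˣ) : ℚ) = -1 := by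
    rw [LinearEquiv.coe_det]
    have : ((rf a).1 : E8Space →ₗ[ℚ] E8Space) = LinearMap.transvection (dotMap (a : E8Space)) (-a) := by
      refine LinearMap.ext fun v => ?_
      simp [LinearMap.transvection, rf_apply, dotMap, sub_eq_add_neg]
    rw [this, LinearMap.transvection.det]
    simp [dotMap, a.2.2.2]
    norm_num
  exact Units.ext h

theorem units_neg_one_ne : (-1 : ℚˣ) ≠ 1 := by
  intro h
  have := congrArg Units.val h
  norm_num at this

/-- Determinant `1` means a word of even length in reflections. The induction also carries words of
odd length, which enter `M` after multiplication by any one reflection. -/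
theorem mem_of_sgn_eq_one {M : Subgroup weylE8} (h : ∀ a b, rf a * rf b ∈ M) {w : weylE8}
    (hw : sgn w = 1) : w ∈ M := by
  have key : (sgn w = 1 ∧ w ∈ M) ∨ (sgn w = -1 ∧ ∀ a, rf a * w ∈ M) := by
    clear hw
    induction w using weyl_induction with
    | h1 => exact Or.inl ⟨map_one _, one_mem _⟩
    | hmul b w ih =>
      rw [map_mul, sgn_rf]
      rcases ih with ⟨h1, h2⟩ | ⟨h1, h2⟩
      · refine Or.inr ⟨by simp [h1], fun a => ?_⟩
        rw [← mul_assoc]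
        exact mul_mem (h a b) h2
      · exact Or.inl ⟨by simp [h1], h2 b⟩
  rcases key with h1 | h1
  · exact h1.2
  · exact absurd (h1.1.symm.trans hw) units_neg_one_ne

theorem sgn_commutator {w : weylE8} (hw : w ∈ commutator weylE8) : sgn w = 1 :=
  MonoidHom.mem_ker.1 (Abelianization.commutator_subset_ker sgn hw)

end E8

/-! ### Simplex frames and the roots in frame coordinates. -/

namespace E8

/-- For an integer, `m ^ 2 - m` is nonnegative and vanishes only at `0` and `1`. -/
theorem zero_or_one_of_sum_sq_le {ι : Type*} [Fintype ι] {m : ι → ℤ}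
    (h : ∑ i, m i ^ 2 ≤ ∑ i, m i) (i : ι) : m i = 0 ∨ m i = 1 := by
  have hnn : ∀ i, 0 ≤ m i ^ 2 - m i := fun i => by
    rcases le_or_gt (m i) 0 with h | h <;> nlinarith
  have h0 : ∑ i, (m i ^ 2 - m i) = 0 :=
    le_antisymm (by rw [Finset.sum_sub_distrib]; omega) (Finset.sum_nonneg fun i _ => hnn i)
  have := (Finset.sum_eq_zero_iff_of_nonneg fun i _ => hnn i).1 h0 i (Finset.mem_univ i)
  have : m i * (m i - 1) = 0 := by linarith [this, sq (m i)]
  rcases mul_eq_zero.1 this with h | h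
  · exact Or.inl h
  · exact Or.inr (by omega)

theorem exists_indicator {ι : Type*} [Fintype ι] [DecidableEq ι] {m : ι → ℤ}
    (h : ∑ i, m i ^ 2 ≤ ∑ i, m i) :
    ∃ s : Finset ι, (s.card : ℤ) = ∑ i, m i ∧ ∀ i, m i = if i ∈ s then 1 else 0 := by
  have h01 := zero_or_one_of_sum_sq_le h
  have hm : ∀ i, m i = if i ∈ Finset.univ.filter (fun i => m i = 1) then 1 else 0 := fun i => by
    rcases h01 i with h | h <;> simp [h]
  refine ⟨Finset.univ.filter fun i => m i = 1, ?_, hm⟩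
  rw [Finset.sum_congr rfl fun i _ => hm i, Finset.sum_ite_mem]
  simp

/-- Nine vectors spanning the space of `E₈`, the vertices of a regular simplex with centre `0`,
whose differences are roots. -/
structure IsFrame (ε : Fin 9 → E8Space) : Prop where
  sum_eq : ∑ i, ε i = 0
  dot : ∀ i j, ε i ⬝ᵥ ε j = (if i = j then 1 else 0) - 1 / 9
  sub_mem_lattice : ∀ i j, ε i - ε j ∈ lattice

namespace IsFrame

variable {ε : Fin 9 → E8Space}

theorem dot_self (h : IsFrame ε) (i : Fin 9) : ε i ⬝ᵥ ε i = 8 / 9 := by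
  rw [h.dot, if_pos rfl]; norm_num

theorem dot_ne (h : IsFrame ε) {i j : Fin 9} (hij : i ≠ j) : ε i ⬝ᵥ ε j = -1 / 9 := by
  rw [h.dot, if_neg hij]; norm_num

theorem sub_mem (h : IsFrame ε) {i j : Fin 9} (hij : i ≠ j) : ε i - ε j ∈ e8Roots := by
  refine mem_roots.2 ⟨h.sub_mem_lattice i j, ?_⟩
  simp only [sub_dotProduct, dotProduct_sub, h.dot_self, h.dot_ne hij, h.dot_ne hij.symm]
  norm_num

/-- Pairing a relation among the first eight vectors with the ninth shows that its coefficients sum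
to zero; pairing with the others then kills each coefficient. -/
theorem span_eq_top (h : IsFrame ε) : Submodule.span ℚ (Set.range ε) = ⊤ := by
  have li : LinearIndependent ℚ (fun i : Fin 8 => ε i.castSucc) := by
    rw [Fintype.linearIndependent_iff]
    intro g hg
    have key : ∀ v, ∑ i, g i * (ε i.castSucc ⬝ᵥ v) = 0 := fun v => by
      have := congrArg (· ⬝ᵥ v) hg
      simpa [sum_dotProduct] using this
    have h0 : ∑ i, g i = 0 := by
      have := key (ε (Fin.last 8))
      simp only [h.dot_ne (Fin.castSucc_lt_last _).ne, ← Finset.sum_mul] at this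
      linarith
    intro j
    have := key (ε j.castSucc)
    simp only [h.dot, Fin.castSucc_inj, mul_sub, Finset.sum_sub_distrib, ← Finset.sum_mul, h0] at this
    simpa using this
  have := li.span_eq_top_of_card_eq_finrank (by simp)
  rw [eq_top_iff, ← this]
  refine Submodule.span_mono ?_
  rintro _ ⟨i, rfl⟩
  exact ⟨_, rfl⟩

theorem linearMap_ext (h : IsFrame ε) {M : Type*} [AddCommGroup M] [Module ℚ M]
    {f g : E8Space →ₗ[ℚ] M} (hfg : ∀ i, f (ε i) = g (ε i)) : f = g :=
  LinearMap.ext_on_range h.span_eq_top hfg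

theorem eq_sum (h : IsFrame ε) (v : E8Space) : v = ∑ i, (v ⬝ᵥ ε i) • ε i := by
  have : LinearMap.id = ∑ i, (dotMap (ε i)).smulRight (ε i) := by
    refine h.linearMap_ext fun j => ?_
    simp [dotMap, h.dot, sub_smul, Finset.sum_sub_distrib, ← Finset.smul_sum, h.sum_eq]
  simpa [dotMap] using congrArg (fun f : E8Space →ₗ[ℚ] E8Space => f v) this

theorem dot_eq_sum (h : IsFrame ε) (u v : E8Space) :
    u ⬝ᵥ v = ∑ i, (u ⬝ᵥ ε i) * (v ⬝ᵥ ε i) := by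
  conv_lhs => rw [h.eq_sum v]
  simp [dotProduct_sum, mul_comm]

theorem sum_dot (h : IsFrame ε) (v : E8Space) : ∑ i, v ⬝ᵥ ε i = 0 := by
  rw [← dotProduct_sum, h.sum_eq, dotProduct_zero]

/-- The numbers `x ⬝ᵥ ε i` differ by integers and sum to zero, so they share a residue `k / 9`
modulo `1`. The norm formula then restricts `k` modulo `9` for vectors of known norm. -/
theorem exists_coords (h : IsFrame ε) {x : E8Space}
    (hx : ∀ i j, ∃ n : ℤ, x ⬝ᵥ (ε i - ε j) = n) :
    ∃ (m : Fin 9 → ℤ) (k : ℤ), (-4 ≤ k ∧ k ≤ 4) ∧ ∑ i, m i = -k ∧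
      (∀ i, x ⬝ᵥ ε i = m i + k / 9) ∧ (9 * ∑ i, m i ^ 2 - k ^ 2 : ℚ) = 9 * (x ⬝ᵥ x) := by
  choose n hn using fun i => hx i 0
  have hn' : ∀ i, x ⬝ᵥ ε i = x ⬝ᵥ ε 0 + n i := fun i => by
    rw [← hn, dotProduct_sub]; ring
  have hs : 9 * (x ⬝ᵥ ε 0) + (∑ i, n i : ℤ) = 0 := by
    have := h.sum_dot x
    rw [Finset.sum_congr rfl fun i _ => hn' i, Finset.sum_add_distrib] at this
    rw [Int.cast_sum, ← this]
    simp
  -- Adding `4` before the division makes it round to the nearest multiple of `9`, so the remainder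
  -- is balanced.
  obtain ⟨q, r, hr, hq⟩ : ∃ q r : ℤ, (-4 ≤ -r ∧ -r ≤ 4) ∧ ∑ i, n i = 9 * q + r :=
    ⟨(∑ i, n i + 4) / 9, ∑ i, n i - 9 * ((∑ i, n i + 4) / 9), by omega, by omega⟩
  have hsum : ∑ i, (n i - q) = r := by
    rw [Finset.sum_sub_distrib, hq]
    simp
  have hc : ∀ i, x ⬝ᵥ ε i = ((n i - q : ℤ) : ℚ) + ((-r : ℤ) : ℚ) / 9 := fun i => by
    rw [hq] at hs
    rw [hn']
    push_cast at hs ⊢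
    linarith
  refine ⟨fun i => n i - q, -r, hr, by rw [hsum, neg_neg], hc, ?_⟩
  have hsum' : ∑ i, ((n i - q : ℤ) : ℚ) = r := by rw [← hsum, Int.cast_sum]
  rw [h.dot_eq_sum]
  have : ∀ i, (x ⬝ᵥ ε i) * (x ⬝ᵥ ε i) =
      ((n i - q : ℤ) : ℚ) ^ 2 - ((n i - q : ℤ) : ℚ) * (2 * r / 9) + r ^ 2 / 81 := fun i => by
    rw [hc]; push_cast; ring
  rw [Finset.sum_congr rfl fun i _ => this i, Finset.sum_add_distrib, Finset.sum_sub_distrib,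
    ← Finset.sum_mul, hsum', Finset.sum_const, Finset.card_univ, Fintype.card_fin, nsmul_eq_mul]
  push_cast
  ring

/-- A vector with given coordinates up to a common shift. -/
theorem eq_sum_of_coords (h : IsFrame ε) {x : E8Space} {m : Fin 9 → ℤ} {c : ℚ}
    (hc : ∀ i, x ⬝ᵥ ε i = m i + c) : x = ∑ i, m i • ε i := by
  rw [h.eq_sum x]
  simp [hc, add_smul, Finset.sum_add_distrib, ← Finset.smul_sum, h.sum_eq, Int.cast_smul_eq_zsmul]

theorem eq_sum_of_sum_sq_le (h : IsFrame ε) {x : E8Space} {m : Fin 9 → ℤ} {c : ℚ}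
    (hc : ∀ i, x ⬝ᵥ ε i = m i + c) (hm : ∑ i, m i ^ 2 ≤ ∑ i, m i) :
    ∃ s : Finset (Fin 9), (s.card : ℤ) = ∑ i, m i ∧ x = ∑ i ∈ s, ε i := by
  obtain ⟨s, hs, hms⟩ := exists_indicator hm
  refine ⟨s, hs, ?_⟩
  rw [h.eq_sum_of_coords hc]
  simp [hms]

/-- These are the shortest nonzero vectors of the dual of the `A₈`-lattice: `9 ∣ k ^ 2 + 8` forces
`k = ±1`, and then up to sign `m` is the indicator of one index. -/
theorem eq_or_eq_neg (h : IsFrame ε) {x : E8Space}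
    (hx : ∀ i j, ∃ n : ℤ, x ⬝ᵥ (ε i - ε j) = n) (hxx : x ⬝ᵥ x = 8 / 9) :
    ∃ i, x = ε i ∨ x = -ε i := by
  obtain ⟨m, k, hk, hsum, hc, hsq⟩ := h.exists_coords hx
  rw [hxx] at hsq
  have hsq : 9 * ∑ i, m i ^ 2 - k ^ 2 = 8 := by
    have : (9 * ∑ i, m i ^ 2 - k ^ 2 : ℚ) = 8 := by rw [hsq]; norm_num
    exact_mod_cast this
  have hk1 : k = -1 ∨ k = 1 := by
    obtain ⟨h1, h2⟩ := hk
    interval_cases k <;> omega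
  rcases hk1 with rfl | rfl
  · obtain ⟨s, hs, hxs⟩ := h.eq_sum_of_sum_sq_le hc (by omega)
    rw [hsum] at hs
    obtain ⟨i, rfl⟩ := Finset.card_eq_one.1 (by omega : s.card = 1)
    exact ⟨i, Or.inl (by simpa using hxs)⟩
  · have hc' : ∀ i, (-x) ⬝ᵥ ε i = ((-m i : ℤ) : ℚ) + -((1 : ℤ) / 9 : ℚ) := fun i => by
      rw [neg_dotProduct, hc]; push_cast; ring
    obtain ⟨s, hs, hxs⟩ := h.eq_sum_of_sum_sq_le hc' (by
      simp only [Finset.sum_neg_distrib, hsum, neg_sq]; omega)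
    simp only [Finset.sum_neg_distrib, hsum] at hs
    obtain ⟨i, rfl⟩ := Finset.card_eq_one.1 (by omega : s.card = 1)
    exact ⟨i, Or.inr (by rw [← neg_eq_iff_eq_neg]; simpa using hxs)⟩

/-- The vectors of the form `ε i + ε j + ε k` with `i`, `j`, `k` distinct. -/
def IsTri (ε : Fin 9 → E8Space) (x : E8Space) : Prop :=
  ∃ i j k, i ≠ j ∧ i ≠ k ∧ j ≠ k ∧ x = ε i + ε j + ε k

/-- The vectors of the form `ε i - ε j` with `i ≠ j`. -/
def diffs (ε : Fin 9 → E8Space) : Set E8Space := {x | ∃ i j, i ≠ j ∧ x = ε i - ε j}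

theorem diff_mem (ε : Fin 9 → E8Space) {i j : Fin 9} (hij : i ≠ j) : ε i - ε j ∈ diffs ε :=
  ⟨i, j, hij, rfl⟩

theorem isTri_of_sum {x : E8Space} {s : Finset (Fin 9)} (hs : s.card = 3)
    (hx : x = ∑ i ∈ s, ε i) : IsTri ε x := by
  obtain ⟨i, j, k, hij, hik, hjk, rfl⟩ := Finset.card_eq_three.1 hs
  refine ⟨i, j, k, hij, hik, hjk, ?_⟩
  rw [hx, Finset.sum_insert (by simp [hij, hik]), Finset.sum_insert (by simp [hjk])]
  simp [add_assoc]

/-- Norm `2` gives `9 ∣ k ^ 2 + 18`, so `k` is `0` or `±3`. For `k = ±3` the coordinates are, up to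
sign, the indicator of three indices; for `k = 0` they are a difference of two unit vectors. -/
theorem root_cases (h : IsFrame ε) {x : E8Space} (hx : x ∈ e8Roots) :
    x ∈ diffs ε ∨ IsTri ε x ∨ IsTri ε (-x) := by
  obtain ⟨m, k, hk, hsum, hc, hsq⟩ :=
    h.exists_coords fun i j => dot_int (mem_roots.1 hx).1 (h.sub_mem_lattice i j)
  rw [(mem_roots.1 hx).2] at hsq
  have hsq : 9 * ∑ i, m i ^ 2 - k ^ 2 = 18 := by
    have : (9 * ∑ i, m i ^ 2 - k ^ 2 : ℚ) = 18 := by rw [hsq]; norm_num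
    exact_mod_cast this
  have hk1 : k = -3 ∨ k = 0 ∨ k = 3 := by
    obtain ⟨h1, h2⟩ := hk
    interval_cases k <;> omega
  rcases hk1 with rfl | rfl | rfl
  · obtain ⟨s, hs, hxs⟩ := h.eq_sum_of_sum_sq_le hc (by omega)
    rw [hsum] at hs
    exact Or.inr (Or.inl (isTri_of_sum (by omega) hxs))
  · left
    have hsum0 : ∑ i, m i = 0 := by omega
    obtain ⟨i, -, hi⟩ : ∃ i ∈ Finset.univ, 0 < m i := by
      refine Finset.exists_pos_of_sum_zero_of_exists_nonzero m hsum0 ?_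
      by_contra! hne
      have : ∑ i, m i ^ 2 = 0 := Finset.sum_eq_zero fun i hi => by rw [hne i hi]; rfl
      omega
    -- Passing to `ε i - x` with `m i > 0` leaves coordinate sum `1` and square sum at most `1`,
    -- which is again the indicator case.
    have hc' : ∀ j, (ε i - x) ⬝ᵥ ε j = (((if i = j then 1 else 0) - m j : ℤ) : ℚ) + (-1 / 9) :=
      fun j => by
        rw [sub_dotProduct, hc, h.dot]
        push_cast
        ring
    have h1 : ∑ j, ((if i = j then 1 else 0) - m j) = 1 := by
      rw [Finset.sum_sub_distrib, hsum0]
      simp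
    have h2 : ∑ j, ((if i = j then 1 else 0) - m j) ^ 2 = 3 - 2 * m i := by
      have : ∀ j, ((if i = j then 1 else 0) - m j) ^ 2 =
          (if i = j then 1 - 2 * m j else 0) + m j ^ 2 := fun j => by
        split_ifs <;> ring
      rw [Finset.sum_congr rfl fun j _ => this j, Finset.sum_add_distrib]
      simp
      omega
    obtain ⟨s, hs, hxs⟩ := h.eq_sum_of_sum_sq_le hc' (by omega)
    rw [h1] at hs
    obtain ⟨j, rfl⟩ := Finset.card_eq_one.1 (by omega : s.card = 1)
    have hxij : x = ε i - ε j := by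
      rw [Finset.sum_singleton] at hxs
      rw [← hxs]; abel
    refine ⟨i, j, ?_, hxij⟩
    rintro rfl
    have := (mem_roots.1 hx).2
    rw [hxij] at this
    simp at this
  · have hc' : ∀ i, (-x) ⬝ᵥ ε i = ((-m i : ℤ) : ℚ) + -((3 : ℤ) / 9 : ℚ) := fun i => by
      rw [neg_dotProduct, hc]; push_cast; ring
    obtain ⟨s, hs, hxs⟩ := h.eq_sum_of_sum_sq_le hc' (by
      simp only [Finset.sum_neg_distrib, hsum, neg_sq]; omega)
    simp only [Finset.sum_neg_distrib, hsum] at hs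
    exact Or.inr (Or.inr (isTri_of_sum (by omega) hxs))

theorem dot_tri_self (h : IsFrame ε) {x : E8Space} (hx : IsTri ε x) : x ⬝ᵥ x = 2 := by
  obtain ⟨i, j, k, hij, hik, hjk, rfl⟩ := hx
  simp only [add_dotProduct, dotProduct_add, h.dot, hij, hik, hjk, hij.symm, hik.symm, hjk.symm,
    if_true, if_false]
  norm_num

theorem tri_not_diff (h : IsFrame ε) {x : E8Space} (hx : IsTri ε x) : x ∉ diffs ε := by
  rintro ⟨a, b, hab, hxab⟩
  obtain ⟨i, j, k, hij, hik, hjk, rfl⟩ := hx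
  have := congrArg (· ⬝ᵥ ε a) hxab
  simp only [sub_dotProduct, add_dotProduct, h.dot, hab.symm, if_true, if_false] at this
  split_ifs at this <;> simp_all <;> norm_num at this

theorem neg_diff {x : E8Space} (hx : x ∈ diffs ε) : -x ∈ diffs ε := by
  obtain ⟨i, j, hij, rfl⟩ := hx
  exact ⟨j, i, hij.symm, by abel⟩

theorem exists_half_int {x : E8Space} (hx : ∀ a ∈ e8Roots, ∃ n : ℤ, x ⬝ᵥ a = n) :
    ∀ i, ∃ n : ℤ, 2 * x i = n := by
  intro i
  obtain ⟨j, hj⟩ : ∃ j, j ≠ i := exists_ne i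
  have hr : ∀ s : ℤ, s = 1 ∨ s = -1 → (Pi.single i 1 + Pi.single j (s : ℚ) : E8Space) ∈ e8Roots := by
    intro s hs
    refine ⟨Or.inl fun k => ⟨(if k = i then 1 else 0) + (if k = j then s else 0), ?_⟩, ?_, ?_⟩
    · simp only [Pi.add_apply, Pi.single_apply]
      push_cast
      rfl
    · simp only [Pi.add_apply, Finset.sum_add_distrib, Finset.sum_pi_single', Finset.mem_univ,
        if_true]
      rcases hs with rfl | rfl
      · exact ⟨1, by norm_num⟩
      · exact ⟨0, by norm_num⟩
    · rcases hs with rfl | rfl <;>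
      simp [hj, hj.symm] <;> norm_num
  obtain ⟨a, ha⟩ := hx _ (hr 1 (Or.inl rfl))
  obtain ⟨b, hb⟩ := hx _ (hr (-1) (Or.inr rfl))
  refine ⟨a + b, ?_⟩
  push_cast
  rw [← ha, ← hb]
  simp only [dotProduct_add, dotProduct_single]
  push_cast
  ring

/-- Some root must be of this shape up to sign: otherwise `ε 0` would pair integrally with all
roots, hence have half-integral coordinates, contradicting its norm `8 / 9`. All sums of three frame
vectors agree modulo differences, so one lattice vector of this shape gives all of them. -/
theorem tri_mem (h : IsFrame ε) {x : E8Space} (hx : IsTri ε x) : x ∈ e8Roots := by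
  obtain ⟨y, hy, hyt⟩ : ∃ y ∈ e8Roots, IsTri ε y := by
    by_contra! hno
    have hd : ∀ y ∈ e8Roots, y ∈ diffs ε := fun y hy => by
      rcases h.root_cases hy with h1 | h1 | h1
      · exact h1
      · exact absurd h1 (hno y hy)
      · refine absurd h1 (hno (-y) (mem_roots.2 ⟨neg_mem (mem_roots.1 hy).1, ?_⟩))
        simpa using (mem_roots.1 hy).2
    have : ∀ a ∈ e8Roots, ∃ n : ℤ, ε 0 ⬝ᵥ a = n := by
      intro a ha
      obtain ⟨i, j, -, rfl⟩ := hd a ha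
      refine ⟨(if 0 = i then 1 else 0) - (if 0 = j then 1 else 0), ?_⟩
      rw [dotProduct_sub, h.dot, h.dot]
      push_cast
      ring
    choose n hn using exists_half_int this
    have h1 : 4 * (ε 0 ⬝ᵥ ε 0) = ((∑ i, n i * n i : ℤ) : ℚ) := by
      simp only [dotProduct, Finset.mul_sum]
      push_cast
      exact Finset.sum_congr rfl fun i _ => by rw [← hn]; ring
    rw [h.dot_self] at h1
    have h2 : (9 * ∑ i, n i * n i : ℤ) = 32 := by
      have : ((9 * ∑ i, n i * n i : ℤ) : ℚ) = 32 := by rw [Int.cast_mul, ← h1]; norm_num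
      exact_mod_cast this
    omega
  refine mem_roots.2 ⟨?_, h.dot_tri_self hx⟩
  obtain ⟨a, b, c, -, -, -, rfl⟩ := hyt
  obtain ⟨i, j, k, -, -, -, rfl⟩ := hx
  have := add_mem (add_mem (add_mem (mem_roots.1 hy).1 (h.sub_mem_lattice i a))
    (h.sub_mem_lattice j b)) (h.sub_mem_lattice k c)
  convert this using 1
  abel

/-- A set of roots that is closed under its reflections, contains `ε i - ε j` for all `i ≠ j`
and one more root contains all roots. -/
theorem roots_subset (h : IsFrame ε) {C : Set E8Space}
    (hC : ∀ a ∈ C, ∀ b ∈ C, b - (b ⬝ᵥ a) • a ∈ C) (hd : diffs ε ⊆ C)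
    {x : E8Space} (hx : x ∈ e8Roots) (hxC : x ∈ C) (hxd : x ∉ diffs ε) : e8Roots ⊆ C := by
  have hneg : ∀ a ∈ C, a ∈ e8Roots → -a ∈ C := fun a ha har => by
    have := hC a ha a ha
    rw [(mem_roots.1 har).2] at this
    convert this using 1
    module
  have hneg_root : ∀ {a}, a ∈ e8Roots → -a ∈ e8Roots := fun {a} ha =>
    mem_roots.2 ⟨neg_mem (mem_roots.1 ha).1, by simpa using (mem_roots.1 ha).2⟩
  obtain ⟨y, hyC, i, j, k, hij, hik, hjk, rfl⟩ : ∃ y ∈ C, IsTri ε y := by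
    rcases h.root_cases hx with h1 | h1 | h1
    · exact absurd h1 hxd
    · exact ⟨x, hxC, h1⟩
    · exact ⟨-x, hneg x hxC hx, h1⟩
  -- Reflection at `ε i - ε l` exchanges one index; such exchanges connect all triples of indices.
  have exch : ∀ {i j k l : Fin 9}, i ≠ j → i ≠ k → l ≠ j → l ≠ k → ε i + ε j + ε k ∈ C →
      ε l + ε j + ε k ∈ C := by
    intro i j k l hij hik hlj hlk hm
    rcases eq_or_ne i l with rfl | hil
    · exact hm
    have := hC (ε i - ε l) (hd (diff_mem ε hil)) _ hm
    have hdot : (ε i + ε j + ε k) ⬝ᵥ (ε i - ε l) = 1 := by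
      simp only [add_dotProduct, dotProduct_sub, h.dot, hil, hij.symm, hik.symm, hlj.symm,
        hlk.symm, if_true, if_false]
      norm_num
    rw [hdot] at this
    convert this using 1
    module
  have all : ∀ y, IsTri ε y → y ∈ C := by
    rintro _ ⟨a, b, c, hab, hac, hbc, rfl⟩
    obtain ⟨j', k', h1, h2, h3, hm⟩ : ∃ j k, a ≠ j ∧ a ≠ k ∧ j ≠ k ∧ ε a + ε j + ε k ∈ C := by
      rcases eq_or_ne a j with rfl | haj
      · exact ⟨i, k, hij.symm, hjk, hik, by rwa [add_comm (ε a)]⟩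
      rcases eq_or_ne a k with rfl | hak
      · exact ⟨i, j, hik.symm, hjk.symm, hij, by rwa [add_assoc, add_comm]⟩
      exact ⟨j, k, haj, hak, hjk, exch hij hik haj hak hyC⟩
    obtain ⟨k'', h4, h5, hm⟩ : ∃ k, a ≠ k ∧ b ≠ k ∧ ε a + ε b + ε k ∈ C := by
      rcases eq_or_ne b k' with rfl | hbk
      · exact ⟨j', h1, h3.symm, by rwa [add_right_comm]⟩
      · refine ⟨k', h2, hbk, ?_⟩
        rw [add_comm (ε a)] at hm ⊢
        exact exch h1.symm h3 hab.symm hbk hm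
    have e : ∀ c : Fin 9, ε a + ε b + ε c = ε c + ε a + ε b := fun c => by abel
    rw [e] at hm ⊢
    exact exch h4.symm h5.symm hac.symm hbc.symm hm
  intro z hz
  rcases h.root_cases hz with h1 | h1 | h1
  · exact hd h1
  · exact all z h1
  · simpa using hneg (-z) (all _ h1) (hneg_root hz)

end IsFrame

end E8

/-! ### From bases of type `A₈` to frames, and the embedding of `Sym₉`. -/

namespace E8

/-- The coefficients of the vectors of the frame that belongs to a base of type `A₈`. -/
def frameCoeff (i : Fin 9) (j : Fin 8) : ℚ := (if i.val ≤ j.val then 1 else 0) - (j.val + 1) / 9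

/-- If `δ j = ε j - ε (j + 1)`, then `ε i` is `ε 8` plus the sum of the `δ j` with `i ≤ j`. Centring
at the mean of the nine vectors produces the term `(j + 1) / 9`. -/
theorem frameCoeff_gram : ∀ i j : Fin 9,
    ∑ k, ∑ l, frameCoeff i k * (frameCoeff j l * (CartanMatrix.A 8 k l : ℚ)) =
      (if i = j then 1 else 0) - 1 / 9 := by
  decide +kernel

/-- The frame that belongs to a base of type `A₈`. -/
def frameOfBase (δ : Fin 8 → E8Space) (i : Fin 9) : E8Space := ∑ j, frameCoeff i j • δ j

theorem frameOfBase_sub (δ : Fin 8 → E8Space) (i k : Fin 9) :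
    frameOfBase δ i - frameOfBase δ k =
      ∑ j : Fin 8, ((if i.val ≤ j.val then 1 else 0) - (if k.val ≤ j.val then 1 else 0) : ℤ) • δ j := by
  rw [frameOfBase, frameOfBase, ← Finset.sum_sub_distrib]
  refine Finset.sum_congr rfl fun j _ => ?_
  rw [← sub_smul, ← Int.cast_smul_eq_zsmul ℚ]
  congr 1
  rw [frameCoeff, frameCoeff]
  push_cast
  ring

theorem frameOfBase_isFrame {δ : Fin 8 → E8Space} (hr : ∀ i, δ i ∈ e8Roots)
    (hg : ∀ i j, δ i ⬝ᵥ δ j = (CartanMatrix.A 8 i j : ℚ)) : IsFrame (frameOfBase δ) where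
  sum_eq := by
    have : ∀ j, ∑ i, frameCoeff i j = 0 := by decide +kernel
    simp only [frameOfBase]
    rw [Finset.sum_comm]
    simp [← Finset.sum_smul, this]
  dot i j := by
    rw [← frameCoeff_gram, Finset.sum_comm]
    simp [frameOfBase, sum_dotProduct, dotProduct_sum, hg, Finset.mul_sum, mul_left_comm]
  sub_mem_lattice i j := by
    rw [frameOfBase_sub]
    exact sum_mem fun k _ => zsmul_mem (mem_roots.1 (hr k)).1 _

theorem frameOfBase_succ (δ : Fin 8 → E8Space) (i : Fin 8) :
    frameOfBase δ i.castSucc - frameOfBase δ i.succ = δ i := by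
  rw [frameOfBase_sub, Finset.sum_eq_single i]
  · simp
  · intro j _ hj
    have : (i : ℕ) ≤ j ↔ (i : ℕ) + 1 ≤ j := by
      have : (i : ℕ) ≠ j := fun h => hj (Fin.ext h.symm)
      omega
    simp [this]
  · simp

/-- Induction on the distance of the indices: reflecting the next base root in the difference
already obtained lengthens that difference by one step. -/
theorem diffs_subset_of_base {δ : Fin 8 → E8Space} (hε : IsFrame (frameOfBase δ)) {C : Set E8Space}
    (hCr : C ⊆ e8Roots) (hC : ∀ a ∈ C, ∀ b ∈ C, b - (b ⬝ᵥ a) • a ∈ C) (hδC : ∀ i, δ i ∈ C) :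
    IsFrame.diffs (frameOfBase δ) ⊆ C := by
  have hneg : ∀ a ∈ C, -a ∈ C := fun a ha => by
    have := hC a ha a ha
    rw [(mem_roots.1 (hCr ha)).2] at this
    convert this using 1
    module
  have hlt : ∀ d : ℕ, ∀ i j : Fin 9, i.val + d + 1 = j.val →
      frameOfBase δ i - frameOfBase δ j ∈ C := by
    intro d
    induction d with
    | zero =>
      intro i j hij
      have h8 : i.val < 8 := by omega
      have hi : i = (⟨i.val, h8⟩ : Fin 8).castSucc := rfl
      have hj : j = (⟨i.val, h8⟩ : Fin 8).succ := Fin.ext (by simp; omega)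
      rw [hi, hj, frameOfBase_succ]
      exact hδC _
    | succ d ih =>
      intro i j hij
      have h9 : i.val + d + 1 < 9 := by omega
      have h1 := ih i ⟨i.val + d + 1, h9⟩ rfl
      have h8 : i.val + d + 1 < 8 := by omega
      have h2 := hδC ⟨i.val + d + 1, h8⟩
      rw [← frameOfBase_succ δ] at h2
      have hj : j = (⟨i.val + d + 1, h8⟩ : Fin 8).succ := Fin.ext (by simp; omega)
      have hk : (⟨i.val + d + 1, h9⟩ : Fin 9) = (⟨i.val + d + 1, h8⟩ : Fin 8).castSucc := rfl
      rw [hk] at h1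
      have h3 := hC _ h1 _ h2
      have hdot : (frameOfBase δ (⟨i.val + d + 1, h8⟩ : Fin 8).castSucc -
          frameOfBase δ (⟨i.val + d + 1, h8⟩ : Fin 8).succ) ⬝ᵥ
          (frameOfBase δ i - frameOfBase δ (⟨i.val + d + 1, h8⟩ : Fin 8).castSucc) = -1 := by
        have e1 : (⟨i.val + d + 1, h8⟩ : Fin 8).castSucc ≠ i := fun e => by
          have := congrArg Fin.val e
          simp at this
          omega
        have e2 : (⟨i.val + d + 1, h8⟩ : Fin 8).succ ≠ i := fun e => by
          have := congrArg Fin.val e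
          simp at this
          omega
        have e3 : (⟨i.val + d + 1, h8⟩ : Fin 8).succ ≠ (⟨i.val + d + 1, h8⟩ : Fin 8).castSucc :=
          (Fin.castSucc_lt_succ).ne'
        rw [sub_dotProduct, dotProduct_sub, dotProduct_sub, hε.dot_ne e1, hε.dot_ne e2,
          hε.dot_ne e3, hε.dot_self]
        norm_num
      rw [hdot] at h3
      rw [hj]
      convert h3 using 1
      module
  rintro _ ⟨i, j, hij, rfl⟩
  rcases lt_or_gt_of_ne hij with h | h
  · exact hlt (j.val - i.val - 1) i j (by have : i.val < j.val := h; omega)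
  · rw [← neg_sub]
    exact hneg _ (hlt (i.val - j.val - 1) j i (by have : j.val < i.val := h; omega))

theorem exists_frame {Φ₀ : Set E8Space} (hΦ₀ : IsA8Subsystem Φ₀) :
    ∃ ε, IsFrame ε ∧ Φ₀ = IsFrame.diffs ε := by
  obtain ⟨δ, hδ, hg, hc⟩ := hΦ₀.exists_base
  have hε := frameOfBase_isFrame (fun i => hΦ₀.subset_roots (hδ i)) hg
  refine ⟨_, hε, Set.Subset.antisymm ?_ ?_⟩
  · intro β hβ
    have hint : ∃ n : ℤ, β ⬝ᵥ frameOfBase δ 0 = n := by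
      obtain ⟨c, rfl, -⟩ := hc β hβ
      have : ∀ i, ∃ n : ℤ, δ i ⬝ᵥ frameOfBase δ 0 = n := fun i =>
        ⟨(if i.castSucc = 0 then 1 else 0) - (if i.succ = 0 then 1 else 0), by
          rw [← frameOfBase_succ δ i, sub_dotProduct, hε.dot, hε.dot]
          push_cast
          ring⟩
      choose n hn using this
      refine ⟨∑ i, c i * n i, ?_⟩
      rw [sum_dotProduct]
      push_cast
      exact Finset.sum_congr rfl fun i _ => by
        rw [← Int.cast_smul_eq_zsmul ℚ, smul_dotProduct, hn, smul_eq_mul]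
    -- Integral combinations of the base pair integrally with each frame vector, whereas a sum of
    -- three frame vectors pairs to `-1 / 3` modulo `1`.
    have hno : ∀ x, IsFrame.IsTri (frameOfBase δ) x → ¬ ∃ n : ℤ, x ⬝ᵥ frameOfBase δ 0 = n := by
      rintro _ ⟨i, j, k, -, -, -, rfl⟩ ⟨n, hn⟩
      simp only [add_dotProduct, hε.dot] at hn
      have : (3 * ((if i = 0 then 1 else 0) + (if j = 0 then 1 else 0) +
          (if k = 0 then 1 else 0) - n : ℤ) : ℚ) = 1 := by
        push_cast
        rw [← hn]
        ring
      have : 3 * ((if i = 0 then 1 else 0) + (if j = 0 then 1 else 0) +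
          (if k = 0 then 1 else 0) - n : ℤ) = 1 := by exact_mod_cast this
      omega
    rcases hε.root_cases (hΦ₀.subset_roots hβ) with h | h | h
    · exact h
    · exact absurd hint (hno _ h)
    · obtain ⟨n, hn⟩ := hint
      exact absurd ⟨-n, by rw [neg_dotProduct, hn]; push_cast; rfl⟩ (hno _ h)
  · exact diffs_subset_of_base hε hΦ₀.subset_roots hΦ₀.reflection_mem hδ

/-- The linear map that permutes the vectors of a frame. -/
def permMap (ε : Fin 9 → E8Space) (σ : Perm (Fin 9)) : E8Space →ₗ[ℚ] E8Space :=
  ∑ i, (dotMap (ε i)).smulRight (ε (σ i))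

namespace IsFrame

variable {ε : Fin 9 → E8Space}

theorem permMap_apply (h : IsFrame ε) (σ : Perm (Fin 9)) (i : Fin 9) :
    permMap ε σ (ε i) = ε (σ i) := by
  simp [permMap, dotMap, h.dot, sub_smul, Finset.sum_sub_distrib, ← Finset.smul_sum,
    Equiv.sum_comp σ ε, h.sum_eq]

theorem permMap_mul (h : IsFrame ε) (σ τ : Perm (Fin 9)) :
    permMap ε (σ * τ) = permMap ε σ ∘ₗ permMap ε τ :=
  h.linearMap_ext fun i => by simp [h.permMap_apply]

theorem permMap_one (h : IsFrame ε) : permMap ε 1 = LinearMap.id :=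
  h.linearMap_ext fun i => by simp [h.permMap_apply]

/-- The action of permutations on the span of a frame. -/
def permEquiv (h : IsFrame ε) : Perm (Fin 9) →* (E8Space ≃ₗ[ℚ] E8Space) where
  toFun σ := LinearEquiv.ofLinearMap (permMap ε σ) (permMap ε σ⁻¹)
    (by rw [← h.permMap_mul, mul_inv_cancel, h.permMap_one])
    (by rw [← h.permMap_mul, inv_mul_cancel, h.permMap_one])
  map_one' := LinearEquiv.toLinearMap_injective h.permMap_one
  map_mul' σ τ := LinearEquiv.toLinearMap_injective (h.permMap_mul σ τ)

/-- The root `ε i - ε j`. -/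
def root (h : IsFrame ε) {i j : Fin 9} (hij : i ≠ j) : e8Roots := ⟨ε i - ε j, h.sub_mem hij⟩

theorem rf_root_apply (h : IsFrame ε) {i j : Fin 9} (hij : i ≠ j) (k : Fin 9) :
    (rf (h.root hij)).1 (ε k) = ε (swap i j k) := by
  rw [rf_apply]
  change ε k - (ε k ⬝ᵥ (ε i - ε j)) • (ε i - ε j) = _
  rw [dotProduct_sub, h.dot, h.dot]
  rcases eq_or_ne k i with rfl | hki
  · simp [hij]
  rcases eq_or_ne k j with rfl | hkj
  · rw [if_neg hki, if_pos rfl, swap_apply_right]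
    module
  · simp [hki, hkj, swap_apply_of_ne_of_ne]

theorem permEquiv_swap (h : IsFrame ε) {i j : Fin 9} (hij : i ≠ j) :
    h.permEquiv (swap i j) = (rf (h.root hij)).1 :=
  LinearEquiv.toLinearMap_injective (h.linearMap_ext fun k =>
    (h.permMap_apply _ k).trans (h.rf_root_apply hij k).symm)

theorem permEquiv_mem (h : IsFrame ε) (σ : Perm (Fin 9)) : h.permEquiv σ ∈ weylE8 := by
  induction σ using Perm.swap_induction_on with
  | one => rw [map_one]; exact one_mem _
  | swap_mul σ i j hij ih =>
    rw [map_mul, h.permEquiv_swap hij]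
    exact mul_mem (rf (h.root hij)).2 ih

/-- The embedding of the symmetric group of a frame into the Weyl group. -/
def permHom (h : IsFrame ε) : Perm (Fin 9) →* weylE8 :=
  h.permEquiv.codRestrict weylE8 h.permEquiv_mem

theorem permHom_apply (h : IsFrame ε) (σ : Perm (Fin 9)) (i : Fin 9) :
    (h.permHom σ).1 (ε i) = ε (σ i) := h.permMap_apply σ i

theorem permHom_swap (h : IsFrame ε) {i j : Fin 9} (hij : i ≠ j) :
    h.permHom (swap i j) = rf (h.root hij) := Subtype.ext (h.permEquiv_swap hij)

theorem injective (h : IsFrame ε) : Function.Injective ε := by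
  intro i j hij
  by_contra hne
  have h1 := h.dot_ne hne
  rw [hij, h.dot_self] at h1
  norm_num at h1

theorem permHom_injective (h : IsFrame ε) : Function.Injective h.permHom := by
  intro σ τ hst
  ext i : 1
  apply h.injective
  rw [← h.permHom_apply, ← h.permHom_apply, hst]

theorem weylSub_diffs (h : IsFrame ε) : weylSub (diffs ε) = h.permHom.range := by
  apply le_antisymm
  · rw [weylSub, Subgroup.closure_le]
    rintro g ⟨a, ⟨i, j, hij, rfl⟩, hg⟩
    exact ⟨swap i j, by rw [h.permHom_swap hij, ← rf_eq (a := h.root hij) hg]⟩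
  · rintro _ ⟨σ, rfl⟩
    induction σ using Perm.swap_induction_on with
    | one => rw [map_one]; exact one_mem _
    | swap_mul σ i j hij ih =>
      rw [map_mul, h.permHom_swap hij]
      exact mul_mem (Subgroup.subset_closure ⟨_, diff_mem ε hij, fun _ => rfl⟩) ih

theorem sgn_permHom (h : IsFrame ε) (σ : Perm (Fin 9)) :
    sgn (h.permHom σ) = Units.map (Int.castRingHom ℚ).toMonoidHom (Perm.sign σ) := by
  induction σ using Perm.swap_induction_on with
  | one => simp
  | swap_mul σ i j hij ih =>
    rw [map_mul, map_mul, h.permHom_swap hij, sgn_rf, ih, map_mul, map_mul, Perm.sign_swap hij]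
    congr 1

theorem finite_diffs (ε : Fin 9 → E8Space) : (diffs ε).Finite :=
  (Set.finite_range fun p : Fin 9 × Fin 9 => ε p.1 - ε p.2).subset <| by
    rintro _ ⟨i, j, -, rfl⟩
    exact ⟨(i, j), rfl⟩

theorem sgn_permHom_eq_one (h : IsFrame ε) {σ : Perm (Fin 9)} :
    sgn (h.permHom σ) = 1 ↔ σ ∈ alternatingGroup (Fin 9) := by
  rw [h.sgn_permHom, Perm.mem_alternatingGroup]
  rcases Int.units_eq_one_or (Perm.sign σ) with h1 | h1 <;> rw [h1]
  · simp
  · have : (-1 : ℤˣ) ≠ 1 := by decide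
    simp only [this, iff_false]
    intro h2
    have := congrArg Units.val h2
    norm_num at this

theorem commutator_weylSub (h : IsFrame ε) :
    ⁅weylSub (diffs ε), weylSub (diffs ε)⁆ = (alternatingGroup (Fin 9)).map h.permHom := by
  rw [h.weylSub_diffs, ← alternatingGroup.commutator_perm_eq (by simp), commutator_def,
    Subgroup.map_commutator, MonoidHom.range_eq_map]

/-- A Weyl group element that maps each `ε i - ε j` to such a vector permutes the frame, up to a
sign. -/
theorem exists_perm (h : IsFrame ε) {w : weylE8} (hw : ∀ a ∈ diffs ε, w.1 a ∈ diffs ε) :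
    ∃ σ, (∀ v, w.1 v = (h.permHom σ).1 v) ∨ (∀ v, w.1 v = -(h.permHom σ).1 v) := by
  have hsurj : ∀ a ∈ diffs ε, ∃ b ∈ diffs ε, w.1 b = a := by
    have := (finite_diffs ε).to_subtype
    have hs : Function.Surjective fun a : diffs ε => (⟨w.1 a, hw a a.2⟩ : diffs ε) :=
      Finite.injective_iff_surjective.1 fun a b hab =>
        Subtype.ext (w.1.injective (congrArg Subtype.val hab))
    intro a ha
    obtain ⟨b, hb⟩ := hs ⟨a, ha⟩
    exact ⟨b, b.2, congrArg Subtype.val hb⟩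
  -- Since `w` permutes the differences, `w.1 (ε i)` pairs integrally with all of them, and
  -- `eq_or_eq_neg` applies. The signs agree because distinct frame vectors always have product `-1
  -- / 9`, never `1 / 9`.
  have key : ∀ i, ∃ (j : Fin 9) (s : ℚ), (s = 1 ∨ s = -1) ∧ w.1 (ε i) = s • ε j := by
    intro i
    obtain ⟨j, hj | hj⟩ := h.eq_or_eq_neg (x := w.1 (ε i)) (fun a b => by
        rcases eq_or_ne a b with rfl | hab
        · exact ⟨0, by simp⟩
        obtain ⟨_, ⟨c, d, -, rfl⟩, he⟩ := hsurj _ (diff_mem ε hab)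
        rw [← he, dot_map, dotProduct_sub, h.dot, h.dot]
        exact ⟨(if i = c then 1 else 0) - (if i = d then 1 else 0), by push_cast; ring⟩)
      (by rw [dot_map, h.dot_self])
    · exact ⟨j, 1, Or.inl rfl, by rw [hj, one_smul]⟩
    · exact ⟨j, -1, Or.inr rfl, by rw [hj, neg_one_smul]⟩
  choose f s hs hf using key
  have hdot : ∀ i j, s i * s j * (ε (f i) ⬝ᵥ ε (f j)) = ε i ⬝ᵥ ε j := fun i j => by
    rw [← dot_map w (ε i), hf, hf, smul_dotProduct, dotProduct_smul, smul_eq_mul, smul_eq_mul, mul_assoc]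
  have hinj : Function.Injective f := by
    intro i j hij
    by_contra hne
    have := hdot i j
    rw [hij, h.dot_self, h.dot_ne hne] at this
    rcases hs i with h1 | h1 <;> rcases hs j with h2 | h2 <;> rw [h1, h2] at this <;>
      norm_num at this
  have hsc : ∀ i, s i = s 0 := by
    intro i
    rcases eq_or_ne i 0 with rfl | hne
    · rfl
    have := hdot i 0
    rw [h.dot_ne (hinj.ne hne), h.dot_ne hne] at this
    rcases hs i with h1 | h1 <;> rcases hs 0 with h2 | h2 <;> rw [h1, h2] at this ⊢ <;>
      norm_num at this
  refine ⟨Equiv.ofBijective f (Finite.injective_iff_bijective.1 hinj), ?_⟩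
  have hw' : ∀ v, w.1 v = s 0 • (h.permHom (Equiv.ofBijective f
      (Finite.injective_iff_bijective.1 hinj))).1 v := by
    intro v
    have : (w.1 : E8Space →ₗ[ℚ] E8Space) = s 0 • ((h.permHom (Equiv.ofBijective f
      (Finite.injective_iff_bijective.1 hinj))).1 : E8Space →ₗ[ℚ] E8Space) :=
      h.linearMap_ext fun i => by
        simp [h.permHom_apply, hf, hsc i]
    exact congrArg (fun g : E8Space →ₗ[ℚ] E8Space => g v) this
  rcases hs 0 with h0 | h0
  · exact Or.inl fun v => by rw [hw', h0, one_smul]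
  · exact Or.inr fun v => by rw [hw', h0, neg_one_smul]

end IsFrame

end E8

/-! ### Explicit Weyl group elements, and products of two reflections. -/

namespace E8

/-- The condition that the vector with coordinates `n i / 2` is a root of `E₈`. -/
abbrev IsDoubleRoot (n : Fin 8 → ℤ) : Prop :=
  ((∀ i, n i % 2 = 0) ∨ (∀ i, n i % 2 = 1)) ∧ (∑ i, n i) % 4 = 0 ∧ n ⬝ᵥ n = 8

/-- The vector with integral coordinates `n i`. -/
def ofInt (n : Fin 8 → ℤ) : E8Space := fun i => n i

theorem ofInt_dot (m n : Fin 8 → ℤ) : ofInt m ⬝ᵥ ofInt n = (m ⬝ᵥ n : ℤ) := by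
  simp [ofInt, dotProduct]

theorem ofInt_sub (m n : Fin 8 → ℤ) : ofInt (m - n) = ofInt m - ofInt n := by
  ext i
  simp [ofInt]

theorem ofInt_smul (c : ℤ) (n : Fin 8 → ℤ) : ofInt (c • n) = (c : ℚ) • ofInt n := by
  ext i
  simp [ofInt]

theorem linearMap_ext_ofInt {f g : E8Space →ₗ[ℚ] E8Space}
    (h : ∀ i, f (ofInt (Pi.single i 1)) = g (ofInt (Pi.single i 1))) : f = g := by
  refine LinearMap.pi_ext' fun i => LinearMap.ext_ring ?_
  have e : ofInt (Pi.single i 1) = Pi.single i (1 : ℚ) := by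
    ext j
    rcases eq_or_ne j i with rfl | hj <;> simp [ofInt, *]
  have := h i
  rwa [e] at this

theorem IsDoubleRoot.mem_roots {n : Fin 8 → ℤ} (h : IsDoubleRoot n) :
    (1 / 2 : ℚ) • ofInt n ∈ e8Roots := by
  obtain ⟨h1, h2, h3⟩ := h
  refine ⟨?_, ⟨(∑ i, n i) / 4, ?_⟩, ?_⟩
  · rcases h1 with h1 | h1
    · refine Or.inl fun i => ⟨n i / 2, ?_⟩
      have : ((n i : ℤ) : ℚ) = ((2 * (n i / 2) : ℤ) : ℚ) := by
        congr 1
        have := h1 i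
        omega
      simp only [Pi.smul_apply, ofInt, this, smul_eq_mul]
      push_cast
      ring
    · refine Or.inr fun i => ⟨n i / 2, ?_⟩
      have : ((n i : ℤ) : ℚ) = ((2 * (n i / 2) + 1 : ℤ) : ℚ) := by
        congr 1
        have := h1 i
        omega
      simp only [Pi.smul_apply, ofInt, this, smul_eq_mul]
      push_cast
      ring
  · have : ((∑ i, n i : ℤ) : ℚ) = ((4 * ((∑ i, n i) / 4) : ℤ) : ℚ) := by
      congr 1
      omega
    simp only [Pi.smul_apply, ofInt, smul_eq_mul, ← Finset.mul_sum, ← Int.cast_sum, this]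
    push_cast
    ring
  · rw [smul_dotProduct, dotProduct_smul, ofInt_dot, h3]
    norm_num

/-- Four times the image of `v` under the product of the reflections at the mutually orthogonal
vectors `a / 2`, where `a` runs through a list of vectors of norm `8`. -/
def reflList (l : List (Fin 8 → ℤ)) (v : Fin 8 → ℤ) : Fin 8 → ℤ :=
  (4 : ℤ) • v - (l.map fun a => (v ⬝ᵥ a) • a).sum

theorem reflList_dot {l : List (Fin 8 → ℤ)} {a : Fin 8 → ℤ} (h : ∀ b ∈ l, b ⬝ᵥ a = 0)
    (v : Fin 8 → ℤ) : reflList l v ⬝ᵥ a = 4 * (v ⬝ᵥ a) := by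
  have h0 : (l.map fun b => (v ⬝ᵥ b) • b).sum ⬝ᵥ a = 0 := by
    induction l with
    | nil => simp
    | cons b l ih =>
      rw [List.map_cons, List.sum_cons, add_dotProduct, smul_dotProduct, h b List.mem_cons_self,
        ih fun c hc => h c (List.mem_cons_of_mem _ hc)]
      simp
  rw [reflList, sub_dotProduct, h0, smul_dotProduct, sub_zero, smul_eq_mul]

/-- For orthogonal roots the corrections simply add up. As the roots are `a / 2`, a factor `4`
clears denominators, so identities between such elements become integer computations. -/
theorem exists_weyl_of_list {l : List (Fin 8 → ℤ)} (hr : ∀ a ∈ l, IsDoubleRoot a)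
    (ho : l.Pairwise fun a b => b ⬝ᵥ a = 0) :
    ∃ w : weylE8, sgn w = (-1) ^ l.length ∧
      ∀ v, (4 : ℚ) • w.1 (ofInt v) = ofInt (reflList l v) := by
  induction l with
  | nil =>
    refine ⟨1, by simp, fun v => ?_⟩
    simp only [reflList, List.map_nil, List.sum_nil, sub_zero, ofInt_smul]
    rfl
  | cons a l ih =>
    rw [List.pairwise_cons] at ho
    obtain ⟨w, hw, hwv⟩ := ih (fun b hb => hr b (List.mem_cons_of_mem _ hb)) ho.2
    refine ⟨rf ⟨_, (hr a List.mem_cons_self).mem_roots⟩ * w, ?_, fun v => ?_⟩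
    · rw [map_mul, sgn_rf, hw, List.length_cons, pow_succ']
    · rw [mul_apply, ← map_smul, hwv, rf_apply, dotProduct_smul, ofInt_dot, reflList_dot ho.1]
      have : reflList (a :: l) v = reflList l v - (v ⬝ᵥ a) • a := by
        simp only [reflList, List.map_cons, List.sum_cons]
        abel
      rw [this, ofInt_sub, ofInt_smul]
      push_cast
      module

/-- The product of the reflections at eight mutually orthogonal roots is `-1`. -/
theorem exists_neg : ∃ z : weylE8, (∀ v, z.1 v = -v) ∧ sgn z = 1 := by
  obtain ⟨z, hz, hzv⟩ := exists_weyl_of_list (l := [![2, 2, 0, 0, 0, 0, 0, 0],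
    ![2, -2, 0, 0, 0, 0, 0, 0], ![0, 0, 2, 2, 0, 0, 0, 0], ![0, 0, 2, -2, 0, 0, 0, 0],
    ![0, 0, 0, 0, 2, 2, 0, 0], ![0, 0, 0, 0, 2, -2, 0, 0], ![0, 0, 0, 0, 0, 0, 2, 2],
    ![0, 0, 0, 0, 0, 0, 2, -2]]) (by decide +kernel) (by decide +kernel)
  refine ⟨z, fun v => ?_, by rw [hz]; exact Even.neg_one_pow (by decide)⟩
  have h1 : (z.1 : E8Space →ₗ[ℚ] E8Space) = -LinearMap.id := by
    refine linearMap_ext_ofInt fun i => smul_right_injective _ (four_ne_zero (α := ℚ)) ?_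
    refine (hzv _).trans ?_
    have : ∀ i : Fin 8, reflList [![2, 2, 0, 0, 0, 0, 0, 0],
      ![2, -2, 0, 0, 0, 0, 0, 0], ![0, 0, 2, 2, 0, 0, 0, 0], ![0, 0, 2, -2, 0, 0, 0, 0],
      ![0, 0, 0, 0, 2, 2, 0, 0], ![0, 0, 0, 0, 2, -2, 0, 0], ![0, 0, 0, 0, 0, 0, 2, 2],
      ![0, 0, 0, 0, 0, 0, 2, -2]] (Pi.single i 1) = (-4 : ℤ) • Pi.single i 1 := by
      decide +kernel
    rw [this, ofInt_smul]
    simp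
  exact congrArg (fun f : E8Space →ₗ[ℚ] E8Space => f v) h1

/-- The element `-1` of the Weyl group. -/
noncomputable def negOne : weylE8 := exists_neg.choose

theorem negOne_apply (v : E8Space) : negOne.1 v = -v := exists_neg.choose_spec.1 v

theorem sgn_negOne : sgn negOne = 1 := exists_neg.choose_spec.2

theorem negOne_mem_center : negOne ∈ Subgroup.center weylE8 :=
  Subgroup.mem_center_iff.2 fun g => ext_weyl fun v => by
    rw [mul_apply, mul_apply, negOne_apply, negOne_apply, map_neg]

theorem negOne_ne_one : negOne ≠ 1 := by
  intro h
  have h1 := negOne_apply (Pi.single 0 1)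
  rw [h] at h1
  have := congrFun h1 0
  simp at this
  norm_num at this

theorem eq_or_eq_neg_of_rf_eq {a b : e8Roots} (h : rf a = rf b) :
    (a : E8Space) = b ∨ (a : E8Space) = -b := by
  have h1 : (rf a).1 a = (rf b).1 a := by rw [h]
  rw [rf_apply, rf_apply, a.2.2.2] at h1
  have h2 : (2 : ℚ) • (a : E8Space) = ((a : E8Space) ⬝ᵥ b) • (b : E8Space) := by
    rw [sub_right_inj] at h1
    exact h1
  have h3 : ((a : E8Space) ⬝ᵥ b) * ((a : E8Space) ⬝ᵥ b) = 4 := by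
    have := congrArg (fun v => (a : E8Space) ⬝ᵥ v) h2
    simp only [dotProduct_smul, a.2.2.2, smul_eq_mul] at this
    linarith
  have h4 : ((a : E8Space) ⬝ᵥ b - 2) * ((a : E8Space) ⬝ᵥ b + 2) = 0 := by linarith
  have h5 : ∀ {u v : E8Space}, (2 : ℚ) • u = (2 : ℚ) • v → u = v := fun h =>
    smul_right_injective _ two_ne_zero h
  rcases mul_eq_zero.1 h4 with h4 | h4
  · rw [sub_eq_zero.1 h4] at h2
    exact Or.inl (h5 h2)
  · rw [eq_neg_of_add_eq_zero_left h4, neg_smul, ← smul_neg] at h2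
    exact Or.inr (h5 h2)

/-- The reflection at `d` is `rf b * rf c * rf b`, and `a(bcb) = (ab)(ac)⁻¹(ab)`. So the roots
linked to a fixed `a` through `M` are closed under their reflections. -/
theorem rf_mul_rf_reflect {M : Subgroup weylE8} {a b c : e8Roots} (hb : rf a * rf b ∈ M)
    (hc : rf a * rf c ∈ M) {d : e8Roots}
    (hd : (d : E8Space) = c - ((c : E8Space) ⬝ᵥ b) • (b : E8Space)) : rf a * rf d ∈ M := by
  have hd' : d = mapRoot (rf b) c := Subtype.ext hd
  rw [hd']
  have : rf a * rf (mapRoot (rf b) c) = rf a * rf b * (rf a * rf c)⁻¹ * (rf a * rf b) := by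
    rw [← conj_rf, mul_inv_rev, rf_inv, rf_inv, rf_inv]
    simp only [mul_assoc]
    rw [← mul_assoc (rf a) (rf a), rf_mul_self, one_mul]
  rw [this]
  exact mul_mem (mul_mem hb (inv_mem hc)) hb

theorem rf_mul_rf_mapRoot_mem (a : e8Roots) (w : weylE8) :
    rf a * rf (mapRoot w a) ∈ commutator weylE8 := by
  have : rf a * rf (mapRoot w a) = ⁅rf a, w⁆ := by
    rw [← conj_rf, commutatorElement_def, rf_inv]
    simp only [mul_assoc]
  rw [this]
  exact Subgroup.commutator_mem_commutator (Subgroup.mem_top _) (Subgroup.mem_top _)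

theorem rf_mul_rf_trans {M : Subgroup weylE8} {a b c : e8Roots} (hb : rf a * rf b ∈ M)
    (hc : rf b * rf c ∈ M) : rf a * rf c ∈ M := by
  have : rf a * rf c = rf a * rf b * (rf b * rf c) := by
    simp only [mul_assoc]
    rw [← mul_assoc (rf b) (rf b), rf_mul_self, one_mul]
  rw [this]
  exact mul_mem hb hc

theorem rf_mul_rf_symm {M : Subgroup weylE8} {a b : e8Roots} (hb : rf a * rf b ∈ M) :
    rf b * rf a ∈ M := by
  have := inv_mem hb
  rwa [mul_inv_rev, rf_inv, rf_inv] at this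

/-! ### The commutator subgroup, the centre and the maximality statements (i) and (ii). -/

namespace IsFrame

variable {ε : Fin 9 → E8Space}

theorem rf_mul_rf_mem (h : IsFrame ε) {M : Subgroup weylE8} {c : e8Roots}
    (hd : ∀ i j (hij : i ≠ j), rf c * rf (h.root hij) ∈ M) {x : e8Roots}
    (hx : (x : E8Space) ∉ diffs ε) (hxM : rf c * rf x ∈ M) (a b : e8Roots) : rf a * rf b ∈ M := by
  have key : e8Roots ⊆ {y | ∃ hy : y ∈ e8Roots, rf c * rf ⟨y, hy⟩ ∈ M} := by
    refine h.roots_subset ?_ ?_ x.2 ⟨x.2, hxM⟩ hx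
    · rintro a ⟨ha, haM⟩ b ⟨hb, hbM⟩
      exact ⟨reflection_mem_roots ha hb, rf_mul_rf_reflect haM hbM rfl⟩
    · rintro _ ⟨i, j, hij, rfl⟩
      exact ⟨h.sub_mem hij, hd i j hij⟩
  obtain ⟨_, ha⟩ := key a.2
  obtain ⟨_, hb⟩ := key b.2
  exact rf_mul_rf_trans (rf_mul_rf_symm ha) hb

theorem rf_root_mul_mem (h : IsFrame ε) {i j k l : Fin 9} (hij : i ≠ j) (hkl : k ≠ l) :
    rf (h.root hij) * rf (h.root hkl) ∈ ⁅weylSub (diffs ε), weylSub (diffs ε)⁆ := by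
  rw [h.commutator_weylSub, ← h.permHom_swap, ← h.permHom_swap, ← map_mul]
  refine Subgroup.mem_map_of_mem _ ?_
  rw [Perm.mem_alternatingGroup, map_mul, Perm.sign_swap hij, Perm.sign_swap hkl]
  rfl

/-- The root `ε 0 + ε 1 + ε 2`. -/
def triRoot (h : IsFrame ε) : e8Roots :=
  ⟨ε 0 + ε 1 + ε 2, h.tri_mem ⟨0, 1, 2, by decide, by decide, by decide, rfl⟩⟩

theorem triRoot_not_diff (h : IsFrame ε) : (h.triRoot : E8Space) ∉ diffs ε :=
  h.tri_not_diff ⟨0, 1, 2, by decide, by decide, by decide, rfl⟩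

theorem triRoot_reflect (h : IsFrame ε) :
    (rf h.triRoot).1 (ε 2 - ε 3) = -(ε 0 + ε 1 + ε 3) := by
  rw [rf_apply]
  change _ - ((ε 2 - ε 3) ⬝ᵥ (ε 0 + ε 1 + ε 2)) • (ε 0 + ε 1 + ε 2) = _
  have : (ε 2 - ε 3) ⬝ᵥ (ε 0 + ε 1 + ε 2) = 1 := by
    simp only [sub_dotProduct, dotProduct_add, h.dot]
    norm_num [Fin.ext_iff]
  rw [this]
  module

theorem triRoot_reflect_not_diff (h : IsFrame ε) : -(ε 0 + ε 1 + ε 3) ∉ diffs ε := fun hd =>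
  h.tri_not_diff (x := ε 0 + ε 1 + ε 3) ⟨0, 1, 3, by decide, by decide, by decide, rfl⟩
    (by simpa using neg_diff hd)

theorem rf_mul_rf_mem_commutator (h : IsFrame ε) (a b : e8Roots) :
    rf a * rf b ∈ commutator weylE8 := by
  have h23 : (2 : Fin 9) ≠ 3 := by decide
  refine h.rf_mul_rf_mem (c := h.root h23) (x := h.triRoot) (fun i j hij => ?_)
    h.triRoot_not_diff ?_ a b
  · exact Subgroup.commutator_mono le_top le_top (h.rf_root_mul_mem h23 hij)
  -- The chosen element maps `ε 2 - ε 3` to `-(ε 0 + ε 1 + ε 2)`, which exhibits the product of the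
  -- two reflections as a commutator.
  · have h1 := rf_mul_rf_mapRoot_mem (h.root h23) (rf (h.root h23) * rf h.triRoot)
    rwa [rf_neg (a := h.triRoot) (b := mapRoot _ _)] at h1
    change (rf (h.root h23)).1 ((rf h.triRoot).1 (ε 2 - ε 3)) = -(ε 0 + ε 1 + ε 2)
    rw [h.triRoot_reflect]
    simp only [map_neg, map_add, h.rf_root_apply]
    simp [swap_apply_of_ne_of_ne]

theorem mem_commutator_iff (h : IsFrame ε) {w : weylE8} : w ∈ commutator weylE8 ↔ sgn w = 1 :=
  ⟨sgn_commutator, mem_of_sgn_eq_one h.rf_mul_rf_mem_commutator⟩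

/-- A central element commutes with each reflection, so it fixes each root up to sign. It is then,
up to sign, a permutation of the frame that centralises `Sym₉`. -/
theorem eq_one_or_negOne_of_mem_center (h : IsFrame ε) {z : weylE8}
    (hz : z ∈ Subgroup.center weylE8) : z = 1 ∨ z = negOne := by
  rw [Subgroup.mem_center_iff] at hz
  have hzd : ∀ a ∈ diffs ε, z.1 a ∈ diffs ε := by
    rintro _ ⟨i, j, hij, rfl⟩
    have h1 : rf (mapRoot z (h.root hij)) = rf (h.root hij) := by
      rw [← conj_rf, ← hz, mul_inv_cancel_right]
    rcases eq_or_eq_neg_of_rf_eq h1 with h2 | h2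
    · have h2 : z.1 (ε i - ε j) = ε i - ε j := h2
      rw [h2]
      exact diff_mem ε hij
    · have h2 : z.1 (ε i - ε j) = -(ε i - ε j) := h2
      rw [h2]
      exact neg_diff (diff_mem ε hij)
  obtain ⟨σ, hσ⟩ := h.exists_perm hzd
  have hcomm : ∀ (τ : Perm (Fin 9)) i, σ (τ i) = τ (σ i) := fun τ i => by
    apply h.injective
    have h1 : (z * h.permHom τ).1 (ε i) = (h.permHom τ * z).1 (ε i) := by rw [hz]
    rw [mul_apply, mul_apply, h.permHom_apply] at h1
    rcases hσ with hσ | hσ <;> rw [hσ, hσ] at h1 <;>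
      simpa only [map_neg, h.permHom_apply, neg_inj] using h1
  have h1 : σ = 1 := by
    ext i : 1
    by_contra hne
    rw [Perm.one_apply] at hne
    obtain ⟨j, hj⟩ : ∃ j, j ∉ ({i, σ i} : Finset (Fin 9)) := by
      by_contra! hall
      have := Finset.card_le_card (fun j _ => hall j : (Finset.univ : Finset (Fin 9)) ⊆ {i, σ i})
      have := Finset.card_le_two (a := i) (b := σ i)
      simp at *
      omega
    simp only [Finset.mem_insert, Finset.mem_singleton, not_or] at hj
    have := hcomm (swap i j) i
    rw [swap_apply_left, swap_apply_of_ne_of_ne hne (Ne.symm hj.2)] at this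
    exact hj.1 (σ.injective this)
  rw [h1, map_one] at hσ
  rcases hσ with hσ | hσ
  · exact Or.inl (ext_weyl hσ)
  · exact Or.inr (ext_weyl fun v => by rw [hσ, negOne_apply]; rfl)

theorem mem_center_iff (h : IsFrame ε) {z : weylE8} :
    z ∈ Subgroup.center weylE8 ↔ z = 1 ∨ z = negOne :=
  ⟨h.eq_one_or_negOne_of_mem_center, by
    rintro (rfl | rfl)
    exacts [one_mem _, negOne_mem_center]⟩

theorem permHom_ne_negOne (h : IsFrame ε) (σ : Perm (Fin 9)) : h.permHom σ ≠ negOne := by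
  intro hσ
  have h1 : -ε 0 = ε (σ 0) := by rw [← h.permHom_apply, hσ, negOne_apply]
  have h2 := congrArg (· ⬝ᵥ ε 0) h1
  simp only [neg_dotProduct, h.dot] at h2
  split_ifs at h2 <;> norm_num at h2

theorem disjoint_center (h : IsFrame ε) :
    Disjoint (Subgroup.center weylE8) (weylSub (diffs ε)) := by
  rw [Subgroup.disjoint_def]
  intro z hz hzW
  rw [h.weylSub_diffs] at hzW
  obtain ⟨σ, rfl⟩ := hzW
  exact (h.eq_one_or_negOne_of_mem_center hz).resolve_right (h.permHom_ne_negOne σ)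

theorem permHom_diffs (h : IsFrame ε) (σ : Perm (Fin 9)) {a : E8Space} (ha : a ∈ diffs ε) :
    (h.permHom σ).1 a ∈ diffs ε := by
  obtain ⟨i, j, hij, rfl⟩ := ha
  rw [map_sub, h.permHom_apply, h.permHom_apply]
  exact diff_mem ε (σ.injective.ne hij)

theorem map_diffs_of_mem_sup (h : IsFrame ε) {w : weylE8}
    (hw : w ∈ Subgroup.center weylE8 ⊔ weylSub (diffs ε)) {a : E8Space} (ha : a ∈ diffs ε) :
    w.1 a ∈ diffs ε := by
  rw [h.weylSub_diffs] at hw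
  obtain ⟨z, hz, _, ⟨σ, rfl⟩, rfl⟩ := Subgroup.mem_sup_of_normal_left.1 hw
  rw [mul_apply]
  rcases h.eq_one_or_negOne_of_mem_center hz with rfl | rfl
  · exact h.permHom_diffs σ ha
  · rw [negOne_apply]
    exact neg_diff (h.permHom_diffs σ ha)

theorem exists_central_mul_permHom (h : IsFrame ε) {w : weylE8} (hw : ∀ a ∈ diffs ε, w.1 a ∈ diffs ε) :
    ∃ z ∈ Subgroup.center weylE8, sgn z = 1 ∧ ∃ σ, w = z * h.permHom σ := by
  obtain ⟨σ, hσ | hσ⟩ := h.exists_perm hw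
  · exact ⟨1, one_mem _, map_one _, σ, by rw [one_mul]; exact ext_weyl hσ⟩
  · exact ⟨negOne, negOne_mem_center, sgn_negOne, σ, ext_weyl fun v => by
      rw [hσ, mul_apply, negOne_apply]⟩

/-- The subgroup is the full stabiliser of the differences. An element outside it conjugates some
reflection of `W₀` to a reflection at a root outside `Φ₀`, and `roots_subset` finishes. -/
theorem isCoatom_sup (h : IsFrame ε) :
    IsCoatom (Subgroup.center weylE8 ⊔ weylSub (diffs ε)) := by
  have h23 : (2 : Fin 9) ≠ 3 := by decide
  refine ⟨fun htop => ?_, fun M hM => ?_⟩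
  · have := h.map_diffs_of_mem_sup (w := rf h.triRoot) (htop ▸ Subgroup.mem_top _) (diff_mem ε h23)
    rw [h.triRoot_reflect] at this
    exact h.triRoot_reflect_not_diff this
  · obtain ⟨hle, g, hgM, hg⟩ := SetLike.lt_iff_le_and_exists.1 hM
    obtain ⟨a, ha, hga⟩ : ∃ a ∈ diffs ε, g.1 a ∉ diffs ε := by
      by_contra! hall
      obtain ⟨z, hz, -, σ, rfl⟩ := h.exists_central_mul_permHom hall
      refine hg (Subgroup.mul_mem_sup hz ?_)
      rw [h.weylSub_diffs]
      exact ⟨σ, rfl⟩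
    have hd : ∀ i j (hij : i ≠ j), rf (h.root hij) ∈ M := fun i j hij =>
      hle (Subgroup.mem_sup_right (Subgroup.subset_closure ⟨_, diff_mem ε hij, fun _ => rfl⟩))
    have key : e8Roots ⊆ {y | ∃ hy : y ∈ e8Roots, rf ⟨y, hy⟩ ∈ M} := by
      obtain ⟨i, j, hij, rfl⟩ := ha
      refine h.roots_subset ?_ ?_ (map_mem_roots g (h.sub_mem hij)) ⟨?_, ?_⟩ hga
      · rintro a ⟨ha, haM⟩ b ⟨hb, hbM⟩
        refine ⟨reflection_mem_roots ha hb, ?_⟩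
        have := mul_mem (mul_mem haM hbM) (inv_mem haM)
        rwa [conj_rf] at this
      · rintro _ ⟨i, j, hij, rfl⟩
        exact ⟨h.sub_mem hij, hd i j hij⟩
      · exact map_mem_roots g (h.sub_mem hij)
      · have := mul_mem (mul_mem hgM (hd i j hij)) (inv_mem hgM)
        rwa [conj_rf] at this
    refine (Subgroup.eq_top_iff' M).2 fun w => ?_
    induction w using weyl_induction with
    | h1 => exact one_mem _
    | hmul a w ih => exact mul_mem (key a.2).2 ih

theorem exists_finset {x : E8Space} (hx : IsTri ε x) :
    ∃ s : Finset (Fin 9), s.card = 3 ∧ x = ∑ i ∈ s, ε i := by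
  obtain ⟨i, j, k, hij, hik, hjk, rfl⟩ := hx
  refine ⟨{i, j, k}, Finset.card_eq_three.2 ⟨i, j, k, hij, hik, hjk, rfl⟩, ?_⟩
  rw [Finset.sum_insert (by simp [hij, hik]), Finset.sum_insert (by simp [hjk])]
  simp [add_assoc]

theorem exists_tri_rf_eq (h : IsFrame ε) {x : e8Roots} (hx : (x : E8Space) ∉ diffs ε) :
    ∃ y : e8Roots, IsTri ε y ∧ rf y = rf x := by
  rcases h.root_cases x.2 with h1 | h1 | h1
  · exact absurd h1 hx
  · exact ⟨x, h1, rfl⟩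
  · exact ⟨⟨_, h.tri_mem h1⟩, h1, rf_neg rfl⟩

/-- If the product of the reflections at two different roots `ε i + ε j + ε k` lies in a subgroup
that contains the alternating group of the frame, then one of these roots is linked in the same
way to a difference. -/
theorem exists_root_rel (h : IsFrame ε) {M : Subgroup weylE8}
    (hM : ⁅weylSub (diffs ε), weylSub (diffs ε)⁆ ≤ M) {x y : e8Roots} (hx : IsTri ε x)
    (hy : IsTri ε y) (hxy : x ≠ y) (hxyM : rf x * rf y ∈ M) :
    ∃ (i j : Fin 9) (hij : i ≠ j), rf x * rf (h.root hij) ∈ M := by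
  obtain ⟨s, hs, hxs⟩ := exists_finset hx
  obtain ⟨t, ht, hyt⟩ := exists_finset hy
  obtain ⟨d, hdt, hds⟩ : ∃ d ∈ t, d ∉ s := by
    by_contra! hts
    have := Finset.eq_of_subset_of_card_le hts (by omega)
    exact hxy (Subtype.ext (by rw [hxs, hyt, this]))
  obtain ⟨e, he, f, hf, hef⟩ : ∃ e ∈ (s ∪ t)ᶜ, ∃ f ∈ (s ∪ t)ᶜ, e ≠ f := by
    rw [← Finset.one_lt_card]
    have := Finset.card_union_le s t
    rw [Finset.card_compl, Fintype.card_fin]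
    omega
  simp only [Finset.mem_compl, Finset.mem_union, not_or] at he hf
  have hde : d ≠ e := fun he' => he.2 (he' ▸ hdt)
  have hdf : d ≠ f := fun hf' => hf.2 (hf' ▸ hdt)
  -- This 3-cycle lies in the alternating group, fixes `x` and replaces `ε d` by `ε e` in `y`.
  -- Reflecting the new root at `y` gives `ε e - ε d`.
  set w := rf (h.root hde) * rf (h.root hef) with hw
  have hwM : w ∈ M := hM (h.rf_root_mul_mem hde hef)
  have hfix : ∀ i, i ≠ d → i ≠ e → i ≠ f → w.1 (ε i) = ε i := fun i h1 h2 h3 => by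
    rw [hw, mul_apply, h.rf_root_apply, h.rf_root_apply, swap_apply_of_ne_of_ne h2 h3,
      swap_apply_of_ne_of_ne h1 h2]
  have hwd : w.1 (ε d) = ε e := by
    rw [hw, mul_apply, h.rf_root_apply, h.rf_root_apply, swap_apply_of_ne_of_ne hde hdf,
      swap_apply_left]
  have hwx : mapRoot w x = x := by
    refine Subtype.ext ?_
    change w.1 x = x
    rw [hxs, map_sum]
    refine Finset.sum_congr rfl fun i hi => hfix i ?_ ?_ ?_
    · rintro rfl; exact hds hi
    · rintro rfl; exact he.1 hi
    · rintro rfl; exact hf.1 hi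
  have hwy : w.1 y = y - ε d + ε e := by
    rw [hyt, ← Finset.add_sum_erase t _ hdt, map_add, map_sum, hwd,
      Finset.sum_congr rfl fun i hi => hfix i (Finset.ne_of_mem_erase hi) ?_ ?_]
    · abel
    · rintro rfl; exact he.2 (Finset.mem_of_mem_erase hi)
    · rintro rfl; exact hf.2 (Finset.mem_of_mem_erase hi)
  have hwxy : rf x * rf (mapRoot w y) ∈ M := by
    have := mul_mem (mul_mem hwM hxyM) (inv_mem hwM)
    have e : w * (rf x * rf y) * w⁻¹ = (w * rf x * w⁻¹) * (w * rf y * w⁻¹) := by group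
    rwa [e, conj_rf, conj_rf, hwx] at this
  have hdot : w.1 y ⬝ᵥ (y : E8Space) = 1 := by
    have h1 : ∀ k, ε k ⬝ᵥ (y : E8Space) = (if k ∈ t then 1 else 0) - 1 / 3 := fun k => by
      rw [hyt, dotProduct_sum]
      simp only [h.dot, Finset.sum_sub_distrib, Finset.sum_const, ht, Finset.sum_ite_eq]
      norm_num
    rw [hwy, add_dotProduct, sub_dotProduct, y.2.2.2, h1, h1, if_pos hdt, if_neg he.2]
    norm_num
  refine ⟨e, d, hde.symm, ?_⟩
  refine rf_mul_rf_reflect hxyM hwxy ?_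
  change ε e - ε d = w.1 y - (w.1 y ⬝ᵥ (y : E8Space)) • (y : E8Space)
  rw [hdot, hwy]
  module

/-- Conjugation by an element `g` outside the stabiliser links the images of all differences to one
another, and one of these images is not a difference. It suffices to link that image to a
difference. -/
theorem sup_covBy (h : IsFrame ε) :
    (Subgroup.center weylE8 ⊔ ⁅weylSub (diffs ε), weylSub (diffs ε)⁆) ⋖ commutator weylE8 := by
  have h23 : (2 : Fin 9) ≠ 3 := by decide
  have hle : Subgroup.center weylE8 ⊔ ⁅weylSub (diffs ε), weylSub (diffs ε)⁆ ≤
      commutator weylE8 := by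
    refine sup_le (fun z hz => ?_) (Subgroup.commutator_mono le_top le_top)
    rw [h.mem_commutator_iff]
    rcases h.eq_one_or_negOne_of_mem_center hz with rfl | rfl
    exacts [map_one _, sgn_negOne]
  refine ⟨lt_of_le_not_ge hle fun hge => ?_, fun M hM hM' => ?_⟩
  · have h1 := h.map_diffs_of_mem_sup
      (sup_le_sup_left (Subgroup.commutator_le_self _) _
        (hge (h.rf_mul_rf_mem_commutator h.triRoot (h.root h23)))) (diff_mem ε h23)
    rw [mul_apply, map_sub, h.rf_root_apply, h.rf_root_apply, swap_apply_left, swap_apply_right,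
      ← neg_sub, map_neg, h.triRoot_reflect] at h1
    exact h.triRoot_reflect_not_diff (by simpa using neg_diff h1)
  · obtain ⟨hle', g, hgM, hg⟩ := SetLike.lt_iff_le_and_exists.1 hM
    have hA := le_sup_right.trans hle'
    obtain ⟨a, ha, hga⟩ : ∃ a ∈ diffs ε, g.1 a ∉ diffs ε := by
      by_contra! hall
      obtain ⟨z, hz, hz1, σ, rfl⟩ := h.exists_central_mul_permHom hall
      refine hg (Subgroup.mul_mem_sup hz ?_)
      rw [h.commutator_weylSub]
      refine Subgroup.mem_map_of_mem _ (h.sgn_permHom_eq_one.1 ?_)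
      have := sgn_commutator (hM'.le hgM)
      rwa [map_mul, hz1, one_mul] at this
    obtain ⟨i, j, hij, rfl⟩ := ha
    have hrel : ∀ k l (hkl : k ≠ l),
        rf (mapRoot g (h.root hij)) * rf (mapRoot g (h.root hkl)) ∈ M := fun k l hkl => by
      have := mul_mem (mul_mem hgM (hA (h.rf_root_mul_mem hij hkl))) (inv_mem hgM)
      have e : g * (rf (h.root hij) * rf (h.root hkl)) * g⁻¹ =
        (g * rf (h.root hij) * g⁻¹) * (g * rf (h.root hkl) * g⁻¹) := by group
      rwa [e, conj_rf, conj_rf] at this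
    obtain ⟨x, hx, hxa⟩ := h.exists_tri_rf_eq (x := mapRoot g (h.root hij)) hga
    -- The image of `ε k - ε i` under `g` is either itself a difference or a second non-difference,
    -- to which `exists_root_rel` applies; the two reflections differ because `k ≠ j`.
    obtain ⟨k, hki, hkj⟩ : ∃ k, k ≠ i ∧ k ≠ j := by
      clear * -
      revert i j
      decide
    obtain ⟨p, q, hpq, hxpq⟩ : ∃ (p q : Fin 9) (hpq : p ≠ q), rf x * rf (h.root hpq) ∈ M := by
      by_cases hgk : (mapRoot g (h.root hki) : E8Space) ∈ diffs ε
      · obtain ⟨p, q, hpq, he⟩ := hgk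
        refine ⟨p, q, hpq, ?_⟩
        have : h.root hpq = mapRoot g (h.root hki) := Subtype.ext he.symm
        rw [this, hxa]
        exact hrel _ _ _
      · obtain ⟨y, hy, hya⟩ := h.exists_tri_rf_eq hgk
        refine h.exists_root_rel hA hx hy ?_ (by rw [hxa, hya]; exact hrel _ _ _)
        rintro rfl
        have h1 : rf (mapRoot g (h.root hij)) = rf (mapRoot g (h.root hki)) := hxa.symm.trans hya
        rw [← conj_rf, ← conj_rf, mul_left_inj, mul_right_inj] at h1
        have h2 := congrArg (fun w : weylE8 => w.1 (ε j)) h1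
        simp only [h.rf_root_apply, swap_apply_right] at h2
        rw [swap_apply_of_ne_of_ne hkj.symm hij.symm] at h2
        exact hij (h.injective h2)
    refine hM'.not_ge fun w hw => mem_of_sgn_eq_one (h.rf_mul_rf_mem (c := h.root hpq)
      (fun i j hij => hA (h.rf_root_mul_mem hpq hij)) (x := x) (h.tri_not_diff hx)
      (rf_mul_rf_symm hxpq)) (sgn_commutator hw)

end IsFrame

end E8

/-! ### A para-octonion product compatible with the roots. -/

namespace E8

/-- Twice the multiplication of a para-octonion algebra whose norm is half the standard form. -/
def twiceMul {R : Type*} [CommRing R] (x y : Fin 8 → R) : Fin 8 → R :=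
  ![
    -x 0 * (y 0 + y 1) - x 1 * (y 0 - y 1) - x 2 * (y 2 + y 3) + x 3 * (y 2 - y 3) - x 4 *
      (y 4 + y 5) + x 5 * (y 4 - y 5) - x 6 * (y 6 - y 7) - x 7 * (y 6 + y 7),
    -x 0 * (y 0 - y 1) + x 1 * (y 0 + y 1) + x 2 * (y 2 - y 3) + x 3 * (y 2 + y 3) + x 4 *
      (y 4 - y 5) + x 5 * (y 4 + y 5) + x 6 * (y 6 + y 7) - x 7 * (y 6 - y 7),
    -x 0 * (y 2 - y 3) + x 1 * (y 2 + y 3) - x 2 * (y 0 - y 1) - x 3 * (y 0 + y 1) + x 4 *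
      (y 6 - y 7) + x 5 * (y 6 + y 7) - x 6 * (y 4 + y 5) + x 7 * (y 4 - y 5),
    -x 0 * (y 2 + y 3) - x 1 * (y 2 - y 3) + x 2 * (y 0 + y 1) - x 3 * (y 0 - y 1) + x 4 *
      (y 6 + y 7) - x 5 * (y 6 - y 7) - x 6 * (y 4 - y 5) - x 7 * (y 4 + y 5),
    -x 0 * (y 4 - y 5) + x 1 * (y 4 + y 5) - x 2 * (y 6 - y 7) - x 3 * (y 6 + y 7) - x 4 *
      (y 0 - y 1) - x 5 * (y 0 + y 1) + x 6 * (y 2 + y 3) - x 7 * (y 2 - y 3),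
    -x 0 * (y 4 + y 5) - x 1 * (y 4 - y 5) - x 2 * (y 6 + y 7) + x 3 * (y 6 - y 7) + x 4 *
      (y 0 + y 1) - x 5 * (y 0 - y 1) + x 6 * (y 2 - y 3) + x 7 * (y 2 + y 3),
    -x 0 * (y 6 + y 7) + x 1 * (y 6 - y 7) + x 2 * (y 4 + y 5) + x 3 * (y 4 - y 5) - x 4 *
      (y 2 + y 3) - x 5 * (y 2 - y 3) - x 6 * (y 0 - y 1) + x 7 * (y 0 + y 1),
    x 0 * (y 6 - y 7) + x 1 * (y 6 + y 7) - x 2 * (y 4 - y 5) + x 3 * (y 4 + y 5) + x 4 *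
      (y 2 - y 3) - x 5 * (y 2 + y 3) - x 6 * (y 0 + y 1) - x 7 * (y 0 - y 1)]

/-- The multiplication of a para-octonion algebra whose norm is half the standard form. -/
def paraMul (x y : E8Space) : E8Space := (1 / 2 : ℚ) • twiceMul x y

theorem paraMul_add_left (x y z : E8Space) :
    paraMul (x + y) z = paraMul x z + paraMul y z := by
  ext i
  fin_cases i <;> simp [paraMul, twiceMul] <;> ring

theorem paraMul_smul_left (c : ℚ) (x y : E8Space) :
    paraMul (c • x) y = c • paraMul x y := by
  ext i
  fin_cases i <;> simp [paraMul, twiceMul] <;> ring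

theorem paraMul_add_right (x y z : E8Space) :
    paraMul x (y + z) = paraMul x y + paraMul x z := by
  ext i
  fin_cases i <;> simp [paraMul, twiceMul] <;> ring

theorem paraMul_smul_right (c : ℚ) (x y : E8Space) :
    paraMul x (c • y) = c • paraMul x y := by
  ext i
  fin_cases i <;> simp [paraMul, twiceMul] <;> ring

/-- `paraMul` as a bilinear map. -/
def mu : E8Space →ₗ[ℚ] E8Space →ₗ[ℚ] E8Space :=
  LinearMap.mk₂ ℚ paraMul paraMul_add_left paraMul_smul_left paraMul_add_right paraMul_smul_right

theorem mu_apply (x y : E8Space) : mu x y = paraMul x y := rfl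

/-- With `mu_mu_right` and `mu_dot` this says that `mu` is a symmetric composition. Roots have norm
`1` for the halved form, so left and right multiplication by a root are mutually inverse. -/
theorem mu_mu_left (x y : E8Space) : mu (mu x y) x = (x ⬝ᵥ x / 2) • y := by
  ext i
  fin_cases i <;> simp [mu_apply, paraMul, twiceMul, dotProduct, Fin.sum_univ_eight] <;> ring

theorem mu_mu_right (x y : E8Space) : mu x (mu y x) = (x ⬝ᵥ x / 2) • y := by
  ext i
  fin_cases i <;> simp [mu_apply, paraMul, twiceMul, dotProduct, Fin.sum_univ_eight] <;> ring

theorem mu_dot (x y z : E8Space) : mu x y ⬝ᵥ z = x ⬝ᵥ mu y z := by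
  simp [mu_apply, paraMul, twiceMul, dotProduct, Fin.sum_univ_eight]
  ring

theorem mu_ofInt (m n : Fin 8 → ℤ) :
    mu ((1 / 2 : ℚ) • ofInt m) (ofInt n) = (1 / 4 : ℚ) • ofInt (twiceMul m n) := by
  ext i
  fin_cases i <;> simp [mu_apply, paraMul, twiceMul, ofInt] <;> ring

/-- Twice the vectors of a base of type `A₈` and one more root. -/
def genInt : Fin 9 → Fin 8 → ℤ :=
  ![![2, -2, 0, 0, 0, 0, 0, 0],
    ![0, 2, -2, 0, 0, 0, 0, 0],
    ![0, 0, 2, -2, 0, 0, 0, 0],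
    ![0, 0, 0, 2, -2, 0, 0, 0],
    ![0, 0, 0, 0, 2, -2, 0, 0],
    ![0, 0, 0, 0, 0, 2, -2, 0],
    ![0, 0, 0, 0, 0, 0, 2, 2],
    ![-1, -1, -1, -1, -1, -1, -1, -1],
    ![0, 0, 0, 0, 0, 0, 2, -2]]

/-- Lists of orthogonal vectors that give the first factor of the multiplications by the vectors
`genInt k / 2` as products of two involutions. -/
def genLeft : Fin 9 → List (Fin 8 → ℤ) :=
  ![[],
    [![0, 2, 2, 0, 0, 0, 0, 0], ![2, 0, 0, 0, 2, 0, 0, 0], ![2, 0, 0, 0, -2, 0, 0, 0],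
     ![0, 0, 0, 0, 0, 2, -2, 0]],
    [![2, 2, 0, 0, 0, 0, 0, 0], ![0, 0, 0, 0, 2, 2, 0, 0], ![0, 0, 0, 0, 2, -2, 0, 0]],
    [![2, 2, 0, 0, 0, 0, 0, 0], ![0, 0, 0, 2, 2, 0, 0, 0], ![0, 0, 2, 0, 0, -2, 0, 0]],
    [![2, 2, 0, 0, 0, 0, 0, 0], ![0, 0, 2, 2, 0, 0, 0, 0], ![0, 0, 2, -2, 0, 0, 0, 0]],
    [![2, 2, 0, 0, 0, 0, 0, 0], ![0, 0, 2, 2, 0, 0, 0, 0], ![0, 0, 2, -2, 0, 0, 0, 0]],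
    [![2, 2, 0, 0, 0, 0, 0, 0], ![0, 0, 2, 2, 0, 0, 0, 0], ![0, 0, 2, -2, 0, 0, 0, 0]],
    [![0, 2, 2, 0, 0, 0, 0, 0], ![0, 0, 0, 2, -2, 0, 0, 0], ![0, 0, 0, 0, 0, 0, 2, -2],
     ![1, -1, 1, -1, -1, -1, -1, -1]],
    [![2, 2, 0, 0, 0, 0, 0, 0], ![0, 0, 2, 2, 0, 0, 0, 0], ![0, 0, 2, -2, 0, 0, 0, 0]]]

/-- Lists of orthogonal vectors that give the second factor of the multiplications by the vectors
`genInt k / 2` as products of two involutions. -/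
def genRight : Fin 9 → List (Fin 8 → ℤ) :=
  ![[![2, 2, 0, 0, 0, 0, 0, 0], ![0, 0, 2, 2, 0, 0, 0, 0], ![0, 0, 2, -2, 0, 0, 0, 0],
     ![0, 0, 0, 0, 2, 2, 0, 0], ![0, 0, 0, 0, 2, -2, 0, 0], ![0, 0, 0, 0, 0, 0, 2, 2],
     ![0, 0, 0, 0, 0, 0, 2, -2]],
    [![0, 0, 0, 0, 2, 2, 0, 0], ![1, 1, 1, 1, 1, -1, 1, -1], ![1, 1, 1, 1, -1, 1, -1, 1]],
    [![0, 2, -2, 0, 0, 0, 0, 0], ![2, 0, 0, -2, 0, 0, 0, 0], ![0, 0, 0, 0, 0, 2, -2, 0],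
     ![0, 0, 0, 0, 2, 0, 0, 2]],
    [![1, 1, 1, 1, 1, 1, -1, -1], ![1, 1, 1, -1, -1, 1, 1, 1], ![1, -1, 1, 1, -1, -1, -1, 1],
     ![1, -1, -1, 1, -1, 1, 1, -1]],
    [![0, 2, 0, 0, -2, 0, 0, 0], ![2, 0, 0, 0, 0, -2, 0, 0], ![0, 0, 0, 2, 0, 0, 2, 0],
     ![0, 0, 2, 0, 0, 0, 0, -2]],
    [![1, 1, 1, -1, 1, 1, 1, -1], ![1, 1, -1, 1, 1, -1, -1, -1], ![1, -1, 1, 1, 1, 1, -1, 1],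
     ![1, -1, -1, -1, -1, 1, -1, -1]],
    [![0, 0, 0, 2, -2, 0, 0, 0], ![0, 0, 2, 0, 0, -2, 0, 0], ![0, 2, 0, 0, 0, 0, -2, 0],
     ![2, 0, 0, 0, 0, 0, 0, 2]],
    [![0, 0, 0, 2, 0, 0, -2, 0], ![1, 1, 1, -1, -1, 1, -1, -1], ![1, 1, -1, -1, 1, -1, -1, 1]],
    [![0, 0, 2, 0, -2, 0, 0, 0], ![0, 0, 0, 2, 0, 2, 0, 0], ![2, 0, 0, 0, 0, 0, 2, 0],
     ![0, 2, 0, 0, 0, 0, 0, 2]]]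

theorem genInt_isDoubleRoot : ∀ k, IsDoubleRoot (genInt k) := by decide +kernel

theorem genLeft_isDoubleRoot : ∀ k, ∀ a ∈ genLeft k, IsDoubleRoot a := by decide +kernel

theorem genRight_isDoubleRoot : ∀ k, ∀ a ∈ genRight k, IsDoubleRoot a := by decide +kernel

theorem genLeft_pairwise : ∀ k, (genLeft k).Pairwise fun a b => b ⬝ᵥ a = 0 := by decide +kernel

theorem genRight_pairwise : ∀ k, (genRight k).Pairwise fun a b => b ⬝ᵥ a = 0 := by decide +kernel

theorem gen_length : ∀ k, (genLeft k).length + (genRight k).length = 7 := by decide +kernel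

/-- The two lists contribute `4 * 4`, while `mu` with the halved vector contributes `1 / 4` of
`twiceMul`; the factor `4` remains. -/
theorem reflList_gen : ∀ k i, reflList (genLeft k) (reflList (genRight k) (Pi.single i 1)) =
    (4 : ℤ) • twiceMul (genInt k) (Pi.single i 1) := by
  decide +kernel

/-- The roots of a base of type `A₈` and one more root. -/
def gen (k : Fin 9) : e8Roots := ⟨_, (genInt_isDoubleRoot k).mem_roots⟩

theorem exists_weyl_mu_gen (k : Fin 9) :
    ∃ w : weylE8, sgn w = -1 ∧ ∀ v, w.1 v = mu (gen k) v := by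
  obtain ⟨u, hu, huv⟩ := exists_weyl_of_list (genLeft_isDoubleRoot k) (genLeft_pairwise k)
  obtain ⟨w, hw, hwv⟩ := exists_weyl_of_list (genRight_isDoubleRoot k) (genRight_pairwise k)
  refine ⟨u * w, ?_, fun v => ?_⟩
  · rw [map_mul, hu, hw, ← pow_add, gen_length]
    exact Odd.neg_one_pow (by decide)
  · have h1 : ((u * w).1 : E8Space →ₗ[ℚ] E8Space) = mu (gen k) := by
      refine linearMap_ext_ofInt fun i =>
        smul_right_injective _ (mul_ne_zero (four_ne_zero (α := ℚ)) (four_ne_zero (α := ℚ))) ?_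
      change (4 * 4 : ℚ) • (u * w).1 (ofInt (Pi.single i 1)) =
        (4 * 4 : ℚ) • mu ((1 / 2 : ℚ) • ofInt (genInt k)) (ofInt (Pi.single i 1))
      rw [mul_apply, mul_smul, ← map_smul, hwv, huv, reflList_gen, mu_ofInt, ofInt_smul]
      push_cast
      module
    exact congrArg (fun f : E8Space →ₗ[ℚ] E8Space => f v) h1

end E8

/-! ### Triality from triples preserving the product, and Clifford relations. -/

namespace E8

theorem mu_mu_add_left (u v w : E8Space) :
    mu (mu u v) w + mu (mu w v) u = (u ⬝ᵥ w) • v := by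
  have h := mu_mu_left (u + w) v
  simp only [map_add, LinearMap.add_apply, mu_mu_left, add_dotProduct, dotProduct_add,
    dotProduct_comm w u] at h
  linear_combination (norm := module) h

theorem mu_mu_add_right (u v w : E8Space) :
    mu u (mu v w) + mu w (mu v u) = (u ⬝ᵥ w) • v := by
  have h := mu_mu_right (u + w) v
  simp only [map_add, LinearMap.add_apply, mu_mu_right, add_dotProduct, dotProduct_add,
    dotProduct_comm w u] at h
  linear_combination (norm := module) h

theorem mu_root_left (a : e8Roots) (v : E8Space) : mu (mu a v) a = v := by
  rw [mu_mu_left, a.2.2.2]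
  norm_num

theorem mu_root_right (a : e8Roots) (v : E8Space) : mu a (mu v a) = v := by
  rw [mu_mu_right, a.2.2.2]
  norm_num

/-- One reflection interchanges the two factors of a product. Two reflections restore the order,
which gives the explicit companions in `rf_rf_mu`. -/
theorem rf_mu (a : e8Roots) (x y : E8Space) : (rf a).1 (mu x y) = -mu (mu y a) (mu a x) := by
  have h := mu_mu_add_left y a (mu a x)
  rw [mu_root_left, dotProduct_comm y, mu_dot, dotProduct_comm] at h
  rw [rf_apply, ← h]
  abel

theorem mu_mu_rf_left (a : e8Roots) (x y : E8Space) :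
    mu (mu x y) a = -mu (mu a y) ((rf a).1 x) := by
  have h := mu_mu_add_left x y a
  rw [rf_apply, map_sub, map_smul, mu_root_left]
  linear_combination (norm := module) h

theorem mu_mu_rf_right (a : e8Roots) (x y : E8Space) :
    mu a (mu x y) = -mu ((rf a).1 y) (mu x a) := by
  have h := mu_mu_add_right a x y
  rw [rf_apply, map_sub, map_smul, LinearMap.sub_apply, LinearMap.smul_apply, mu_root_right,
    dotProduct_comm y]
  linear_combination (norm := module) h

theorem rf_rf_mu (a b : e8Roots) (x y : E8Space) :
    (rf a * rf b).1 (mu x y) = mu (mu (mu b x) a) (mu a (mu y b)) := by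
  rw [mul_apply, rf_mu, map_neg, rf_mu, neg_neg]

theorem mu_mu_mu (a b : e8Roots) (x y : E8Space) :
    mu a (mu (mu x y) b) = mu ((rf a * rf b).1 x) (mu (mu b y) a) := by
  rw [mu_mu_rf_left, map_neg, mu_mu_rf_right, neg_neg, mul_apply]

/-- The para-unit of the multiplication `mu`. -/
def paraUnit : E8Space := ![1, -1, 0, 0, 0, 0, 0, 0]

theorem paraUnit_mu (v : E8Space) :
    mu paraUnit v = ![-v 1, -v 0, -v 2, -v 3, -v 4, -v 5, -v 6, -v 7] := by
  ext i
  fin_cases i <;> simp [paraUnit, mu_apply, paraMul, twiceMul] <;> ring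

theorem mu_paraUnit (v : E8Space) : mu v paraUnit = mu paraUnit v := by
  ext i
  fin_cases i <;> simp [paraUnit, mu_apply, paraMul, twiceMul] <;> ring

theorem paraUnit_mu_mu (v : E8Space) : mu paraUnit (mu paraUnit v) = v := by
  ext i
  fin_cases i <;> simp [paraUnit_mu]

/-- The nucleus of the multiplication consists of the multiples of the para-unit. -/
theorem eq_smul_paraUnit {b : E8Space}
    (h : ∀ x y, mu (mu paraUnit (mu x y)) b = mu x (mu paraUnit (mu y b))) :
    ∃ c : ℚ, b = c • paraUnit := by
  -- Seven coordinates of two instances already give enough linear equations to determine `b` from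
  -- `b 0`.
  have h1 := h ![0, 0, 1, 0, 0, 0, 0, 0] ![0, 0, 0, 0, 1, 0, 0, 0]
  have h2 := h ![0, 0, 0, 1, 0, 0, 0, 0] ![0, 0, 0, 0, 0, 0, 1, 0]
  have h10 := congrFun h1 0
  have h13 := congrFun h1 3
  have h15 := congrFun h1 5
  have h16 := congrFun h1 6
  have h20 := congrFun h2 0
  have h22 := congrFun h2 2
  have h27 := congrFun h2 7
  clear h1 h2
  simp [paraUnit, mu_apply, paraMul, twiceMul] at h10 h13 h15 h16 h20 h22 h27
  refine ⟨b 0, ?_⟩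
  ext i
  fin_cases i <;> simp [paraUnit] <;> linarith

/-- Linear maps `B`, `C` with `C (x ∘ y) = x ∘ B y` are equal scalars. -/
theorem exists_scalar {B C : E8Space →ₗ[ℚ] E8Space} (h : ∀ x y, C (mu x y) = mu x (B y)) :
    ∃ c : ℚ, (∀ v, B v = c • v) ∧ ∀ v, C v = c • v := by
  -- Both maps are determined by `B paraUnit`, because multiplying twice by the para-unit is the
  -- identity. The hypothesis then becomes the nucleus condition on `B paraUnit`.
  have hC : ∀ v, C v = mu (mu paraUnit v) (B paraUnit) := fun v => by
    rw [← h, mu_paraUnit, paraUnit_mu_mu]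
  have hB : ∀ v, B v = mu paraUnit (mu v (B paraUnit)) := fun v => by
    rw [← paraUnit_mu_mu (B v), ← h, hC, paraUnit_mu_mu]
  obtain ⟨c, hc⟩ := eq_smul_paraUnit fun x y => by rw [← hC, h, hB]
  refine ⟨c, fun v => ?_, fun v => ?_⟩
  · rw [hB, hc, map_smul, map_smul, mu_paraUnit, paraUnit_mu_mu]
  · rw [hC, hc, map_smul, mu_paraUnit, paraUnit_mu_mu]

/-- The operator `(x, y) ↦ (y ∘ v, v ∘ x)`. -/
def clifford (v : E8Space) : Module.End ℚ (E8Space × E8Space) :=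
  ((mu.flip v) ∘ₗ LinearMap.snd ℚ E8Space E8Space).prod
    ((mu v) ∘ₗ LinearMap.fst ℚ E8Space E8Space)

theorem clifford_apply (v : E8Space) (p : E8Space × E8Space) :
    clifford v p = (mu p.2 v, mu v p.1) := rfl

theorem clifford_anticomm (u v : E8Space) :
    clifford u * clifford v + clifford v * clifford u = (u ⬝ᵥ v) • 1 := by
  refine LinearMap.ext fun p => Prod.ext ?_ ?_
  · change mu (mu v p.1) u + mu (mu u p.1) v = (u ⬝ᵥ v) • p.1
    rw [mu_mu_add_left, dotProduct_comm]
  · exact mu_mu_add_right u p.2 v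

theorem clifford_mul_self (a : e8Roots) : clifford a * clifford a = 1 :=
  LinearMap.ext fun p => Prod.ext (mu_root_left a p.1) (mu_root_right a p.2)

theorem clifford_add (u v : E8Space) : clifford (u + v) = clifford u + clifford v :=
  LinearMap.ext fun p => by simp [clifford_apply]

theorem clifford_sub (u v : E8Space) : clifford (u - v) = clifford u - clifford v :=
  LinearMap.ext fun p => by simp [clifford_apply]

/-- The relations are those of the roots `ε 0 - ε 1`, `ε 2 - ε 3`, `ε 0 - ε 2` of `A₃`, and `g - p +
q` stands for `ε 1 - ε 3`. In `D₃ = A₃` the two products are half-turns in coordinate planes sharing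
one axis, so their spin lifts anticommute. -/
theorem anticomm_of_relations {R : Type*} [Ring R] {p q g : R} (hp : p * p = 1) (hq : q * q = 1)
    (hg : g * g = 1) (hpq : p * q + q * p = 0) (hpg : p * g + g * p = 1)
    (hqg : q * g + g * q = -1) :
    (p * q) * (g * (g - p + q)) = -((g * (g - p + q)) * (p * q)) := by
  have hqp : q * p = -(p * q) := eq_neg_of_add_eq_zero_right hpq
  have hpg' : p * g = 1 - g * p := eq_sub_of_add_eq hpg
  have hqg' : q * g = -1 - g * q := eq_sub_of_add_eq hqg
  have e1 : g * (g - p + q) = 1 - g * p + g * q := by rw [mul_add, mul_sub, hg]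
  have e2 : (p * q) * g = -p - q + g * (p * q) := by
    rw [mul_assoc, hqg', mul_sub, ← mul_assoc, hpg', sub_mul, mul_assoc]
    noncomm_ring
  have e3 : (p * q) * p = -q := by rw [mul_assoc, hqp, mul_neg, ← mul_assoc, hp, one_mul]
  have e4 : (p * q) * q = p := by rw [mul_assoc, hq, mul_one]
  have e5 : p * (p * q) = q := by rw [← mul_assoc, hp, one_mul]
  have e6 : q * (p * q) = -p := by rw [← mul_assoc, hqp, neg_mul, e4]
  have e7 : (p * q) * (g * p) = -1 - q * p + g * (-q) := by
    rw [← mul_assoc, e2, add_mul, sub_mul, neg_mul, hp, mul_assoc, e3]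
  have e8 : (p * q) * (g * q) = -(p * q) - 1 + g * p := by
    rw [← mul_assoc, e2, add_mul, sub_mul, neg_mul, hq, mul_assoc, e4]
  simp only [e1, mul_add, mul_sub, add_mul, sub_mul, e7, e8, mul_one, one_mul, mul_assoc g p,
    mul_assoc g q, e5, e6, hqp]
  noncomm_ring

theorem mu_anticomm {a b c d : e8Roots} (hab : (a : E8Space) ⬝ᵥ b = 0)
    (hac : (a : E8Space) ⬝ᵥ c = 1) (hbc : (b : E8Space) ⬝ᵥ c = -1)
    (hd : (d : E8Space) = c - a + b) (v : E8Space) :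
    mu (mu b (mu (mu d v) c)) a = -mu (mu d (mu (mu b v) a)) c := by
  have h1 := clifford_anticomm a b
  have h2 := clifford_anticomm a c
  have h3 := clifford_anticomm b c
  rw [hab, zero_smul] at h1
  rw [hac, one_smul] at h2
  rw [hbc, show (-1 : ℚ) • (1 : Module.End ℚ (E8Space × E8Space)) = -1 from
    LinearMap.ext fun p => neg_one_smul ℚ p] at h3
  have h := anticomm_of_relations (clifford_mul_self a) (clifford_mul_self b)
    (clifford_mul_self c) h1 h2 h3
  rw [← clifford_sub, ← clifford_add, ← hd] at h
  -- On the first summand, `clifford a * clifford b` acts as `v ↦ mu (mu b v) a`.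
  exact congrArg (fun f : Module.End ℚ (E8Space × E8Space) => (f (v, 0)).1) h

/-- The group `W'`. -/
abbrev Derived : Type := ↥(commutator weylE8)

/-- The triples of elements of `W'` that preserve the multiplication `mu`. -/
def triples : Subgroup (Derived × Derived × Derived) where
  carrier := {p | ∀ x y, p.2.2.1.1 (mu x y) = mu (p.1.1.1 x) (p.2.1.1.1 y)}
  one_mem' _ _ := rfl
  mul_mem' {p q} hp hq x y := by
    change p.2.2.1.1 (q.2.2.1.1 (mu x y)) = mu (p.1.1.1 (q.1.1.1 x)) (p.2.1.1.1 (q.2.1.1.1 y))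
    rw [hq, hp]
  inv_mem' {p} hp x y := by
    change (p.2.2.1)⁻¹.1 (mu x y) = mu ((p.1.1)⁻¹.1 x) ((p.2.1.1)⁻¹.1 y)
    apply p.2.2.1.1.injective
    rw [apply_inv_apply, hp, apply_inv_apply, apply_inv_apply]

theorem eq_of_forall_dot {u v : E8Space} (h : ∀ w, u ⬝ᵥ w = v ⬝ᵥ w) : u = v := by
  ext i
  simpa using h (Pi.single i 1)

/-- By orthogonality, a triple preserves the trilinear form `mu x y ⬝ᵥ z`, which is invariant under
cyclic permutation of its arguments by `mu_dot`. -/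
theorem rotate_mem {p : Derived × Derived × Derived} (hp : p ∈ triples) :
    (p.2.1, p.2.2, p.1) ∈ triples := by
  intro x y
  change p.1.1.1 (mu x y) = mu (p.2.1.1.1 x) (p.2.2.1.1 y)
  refine eq_of_forall_dot fun w => ?_
  obtain ⟨z, rfl⟩ : ∃ z, p.1.1.1 z = w := ⟨_, apply_inv_apply p.1.1 w⟩
  rw [dot_map, dotProduct_comm _ (p.1.1.1 z), ← mu_dot, ← hp, dot_map, mu_dot, mu_dot,
    dotProduct_comm, mu_dot, dotProduct_comm y, mu_dot]

/-- The cyclic permutation of the triples. -/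
def rotate : triples ≃* triples where
  toFun p := ⟨(p.1.2.1, p.1.2.2, p.1.1), rotate_mem p.2⟩
  invFun p := ⟨(p.1.2.2, p.1.1, p.1.2.1), rotate_mem (rotate_mem p.2)⟩
  left_inv _ := rfl
  right_inv _ := rfl
  map_mul' _ _ := rfl

theorem genInt_gram : ∀ i j : Fin 8,
    genInt i.castSucc ⬝ᵥ genInt j.castSucc = 4 * CartanMatrix.A 8 i j := by
  decide +kernel

theorem gen_dot (i j : Fin 9) :
    (gen i : E8Space) ⬝ᵥ (gen j : E8Space) = ((genInt i ⬝ᵥ genInt j : ℤ) : ℚ) / 4 := by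
  change ((1 / 2 : ℚ) • ofInt (genInt i)) ⬝ᵥ ((1 / 2 : ℚ) • ofInt (genInt j)) = _
  rw [smul_dotProduct, dotProduct_smul, ofInt_dot, smul_eq_mul, smul_eq_mul]
  ring

/-- The base of type `A₈` that consists of the first eight roots `gen k`. -/
def genBase (i : Fin 8) : E8Space := gen i.castSucc

theorem isFrame_genBase : IsFrame (frameOfBase genBase) :=
  frameOfBase_isFrame (fun i => (gen i.castSucc).2) fun i j => by
    rw [genBase, genBase, gen_dot, genInt_gram]
    push_cast
    ring

theorem gen_not_diff : (gen 8 : E8Space) ∉ IsFrame.diffs (frameOfBase genBase) := by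
  rintro ⟨i, j, -, hij⟩
  have h1 : (gen 8 : E8Space) ⬝ᵥ frameOfBase genBase 0 = -1 / 3 := by
    rw [frameOfBase, dotProduct_sum]
    simp only [dotProduct_smul, genBase, gen_dot]
    have : ∑ j : Fin 8, frameCoeff 0 j • (((genInt 8 ⬝ᵥ genInt j.castSucc : ℤ) : ℚ) / 4) =
      -1 / 3 := by decide +kernel
    exact this
  rw [hij, sub_dotProduct, isFrame_genBase.dot, isFrame_genBase.dot] at h1
  split_ifs at h1 <;> norm_num at h1

theorem mem_derived_iff {w : weylE8} : w ∈ commutator weylE8 ↔ sgn w = 1 :=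
  isFrame_genBase.mem_commutator_iff

theorem exists_triple_gen (i j : Fin 9) :
    ∃ p ∈ triples, p.2.2.1 = rf (gen i) * rf (gen j) := by
  obtain ⟨u, hu, huv⟩ := exists_weyl_mu_gen i
  obtain ⟨w, hw, hwv⟩ := exists_weyl_mu_gen j
  have hu' : ∀ v, u⁻¹.1 v = mu v (gen i) := fun v => by
    apply u.1.injective
    rw [apply_inv_apply, huv, mu_root_right]
  have hw' : ∀ v, w⁻¹.1 v = mu v (gen j) := fun v => by
    apply w.1.injective
    rw [apply_inv_apply, hwv, mu_root_right]
  refine ⟨(⟨u⁻¹ * w, mem_derived_iff.2 (by simp [hu, hw])⟩,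
    ⟨u * w⁻¹, mem_derived_iff.2 (by simp [hu, hw])⟩,
    ⟨rf (gen i) * rf (gen j), mem_derived_iff.2 (by simp [sgn_rf])⟩), fun x y => ?_, rfl⟩
  change (rf (gen i) * rf (gen j)).1 (mu x y) = mu ((u⁻¹ * w).1 x) ((u * w⁻¹).1 y)
  rw [rf_rf_mu, mul_apply, mul_apply, hu', hwv, huv, hw']

/-- The projection of the triples to `W' / Z(W)`. -/
def toOmegaFst : triples →* WeylE8Omega :=
  toOmega.comp ((MonoidHom.fst _ _).comp triples.subtype)

theorem toOmegaFst_apply (p : triples) : toOmegaFst p = toOmega p.1.1 := rfl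

/-- The third entries of triples form a subgroup. It contains the products of reflections at the
nine roots `gen k`, which generate all even words; rotation moves the third entry to the first
place. -/
theorem exists_triple (d : Derived) : ∃ p : triples, p.1.1 = d := by
  let M : Subgroup weylE8 := (triples.map ((MonoidHom.snd _ _).comp (MonoidHom.snd _ _))).map
    (commutator weylE8).subtype
  have hM : ∀ {w}, w ∈ M ↔ ∃ p ∈ triples, p.2.2.1 = w := fun {w} =>
    ⟨fun ⟨_, ⟨p, hp, hpd⟩, hd⟩ => ⟨p, hp, (congrArg Subtype.val hpd).trans hd⟩,
      fun ⟨p, hp, hw⟩ => ⟨p.2.2, ⟨p, hp, rfl⟩, hw⟩⟩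
  have hgen : ∀ i j, rf (gen i) * rf (gen j) ∈ M := fun i j => hM.2 (exists_triple_gen i j)
  have hroot : ∀ i j (hij : i ≠ j), rf (gen 0) * rf (isFrame_genBase.root hij) ∈ M := by
    have := diffs_subset_of_base (δ := genBase) isFrame_genBase
      (C := {y | ∃ hy : y ∈ e8Roots, rf (gen 0) * rf ⟨y, hy⟩ ∈ M}) (fun y hy => hy.1)
      (by
        rintro a ⟨ha, haM⟩ b ⟨hb, hbM⟩
        exact ⟨reflection_mem_roots ha hb, rf_mul_rf_reflect haM hbM rfl⟩)
      (fun i => ⟨(gen i.castSucc).2, hgen 0 i.castSucc⟩)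
    exact fun i j hij => (this (IsFrame.diff_mem _ hij)).2
  have hall := isFrame_genBase.rf_mul_rf_mem hroot gen_not_diff (hgen 0 8)
  obtain ⟨p, hp, hpd⟩ := hM.1 (mem_of_sgn_eq_one hall (sgn_commutator d.2))
  exact ⟨⟨(p.2.2, p.1, p.2.1), rotate_mem (rotate_mem hp)⟩, Subtype.ext hpd⟩

theorem toOmegaFst_surjective : Function.Surjective toOmegaFst := by
  intro x
  obtain ⟨d, rfl⟩ := QuotientGroup.mk'_surjective _ x
  obtain ⟨p, rfl⟩ := exists_triple d
  exact ⟨p, rfl⟩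

theorem toOmega_eq_one {d : Derived} : toOmega d = 1 ↔ d.1 ∈ Subgroup.center weylE8 :=
  (QuotientGroup.eq_one_iff d).trans Subgroup.mem_subgroupOf

theorem mem_center_of_smul {w : weylE8} {c : ℚ} (h : ∀ v, w.1 v = c • v) :
    w ∈ Subgroup.center weylE8 := by
  rw [Subgroup.mem_center_iff]
  exact fun g => ext_weyl fun v => by rw [mul_apply, mul_apply, h, h, map_smul]

/-- A first entry `±1` makes the other two entries scalar by `exists_scalar`. So the rotation is
well defined modulo the centre. -/
theorem rotate_mem_ker {p : triples} (hp : toOmegaFst p = 1) : toOmegaFst (rotate p) = 1 := by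
  rw [toOmegaFst_apply, toOmega_eq_one] at hp ⊢
  change p.1.2.1.1 ∈ _
  have hs : ∃ s : ℚ, s * s = 1 ∧ ∀ v, p.1.1.1.1 v = s • v := by
    rcases isFrame_genBase.eq_one_or_negOne_of_mem_center hp with h | h <;> rw [h]
    · exact ⟨1, by norm_num, fun v => (one_smul _ v).symm⟩
    · exact ⟨-1, by norm_num, fun v => by rw [negOne_apply, neg_one_smul]⟩
  obtain ⟨s, hs, hsv⟩ := hs
  obtain ⟨c, hc, -⟩ := exists_scalar (B := s • (p.1.2.1.1.1 : E8Space →ₗ[ℚ] E8Space))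
    (C := (p.1.2.2.1.1 : E8Space →ₗ[ℚ] E8Space)) (fun x y => by
      refine (p.2 x y).trans ?_
      rw [hsv]
      simp)
  refine mem_center_of_smul (c := s * c) fun v => ?_
  rw [mul_smul, ← hc, LinearMap.smul_apply, smul_smul, hs, one_smul]
  rfl

/-- The triality automorphism: it is induced by the cyclic permutation of the triples. -/
theorem exists_triality :
    ∃ τ : MulAut WeylE8Omega, ∀ p, τ (toOmegaFst p) = toOmegaFst (rotate p) := by
  have hker : toOmegaFst.ker ≤ (toOmegaFst.comp rotate.toMonoidHom).ker := fun p hp =>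
    rotate_mem_ker hp
  let f : WeylE8Omega →* WeylE8Omega :=
    toOmegaFst.liftOfSurjective toOmegaFst_surjective ⟨_, hker⟩
  have hf : ∀ p, f (toOmegaFst p) = toOmegaFst (rotate p) := fun p =>
    MonoidHom.liftOfRightInverse_comp_apply _ _ _ _ p
  refine ⟨MulEquiv.ofBijective f ⟨?_, ?_⟩, hf⟩
  · rw [injective_iff_map_eq_one]
    intro x hx
    obtain ⟨p, rfl⟩ := toOmegaFst_surjective x
    rw [hf] at hx
    exact rotate_mem_ker (rotate_mem_ker hx)
  · intro x
    obtain ⟨p, rfl⟩ := toOmegaFst_surjective x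
    exact ⟨toOmegaFst (rotate (rotate p)), hf _⟩

/-- The companions of a first entry are unique up to a scalar, so the second entry can be compared
with the explicit one obtained from `mu_mu_mu`. -/
theorem triple_eq_smul {p : triples} {a b : e8Roots} (hp : p.1.1.1 = rf a * rf b) :
    ∃ c : ℚ, ∀ v, p.1.2.1.1.1 v = c • mu (mu b v) a := by
  obtain ⟨c, hc, -⟩ := exists_scalar
    (B := (p.1.2.1.1.1 : E8Space →ₗ[ℚ] E8Space) ∘ₗ mu.flip b ∘ₗ mu a)
    (C := (p.1.2.2.1.1 : E8Space →ₗ[ℚ] E8Space) ∘ₗ mu b ∘ₗ mu.flip a) (fun x y => by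
      change p.1.2.2.1.1 (mu b (mu (mu x y) a)) = mu x (p.1.2.1.1.1 (mu (mu a y) b))
      rw [mu_mu_mu]
      refine (p.2 _ _).trans ?_
      rw [hp, ← mul_apply, mul_assoc, ← mul_assoc (rf b), rf_mul_self, one_mul, rf_mul_self]
      rfl)
  refine ⟨c, fun v => ?_⟩
  rw [← hc]
  change _ = p.1.2.1.1.1 (mu (mu a (mu (mu b v) a)) b)
  rw [mu_root_right, mu_root_left]

theorem triple_anticomm {p q : triples} {a b c d : e8Roots} (hab : (a : E8Space) ⬝ᵥ b = 0)
    (hac : (a : E8Space) ⬝ᵥ c = 1) (hbc : (b : E8Space) ⬝ᵥ c = -1)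
    (hd : (d : E8Space) = c - a + b) (hp : p.1.1.1 = rf a * rf b) (hq : q.1.1.1 = rf c * rf d) :
    p.1.2.1.1 * q.1.2.1.1 = negOne * (q.1.2.1.1 * p.1.2.1.1) := by
  obtain ⟨s, hs⟩ := triple_eq_smul hp
  obtain ⟨t, ht⟩ := triple_eq_smul hq
  refine ext_weyl fun v => ?_
  rw [mul_apply, mul_apply, negOne_apply, mul_apply, hs, ht, ht, hs]
  simp only [map_smul, LinearMap.smul_apply, mu_anticomm hab hac hbc hd]
  module

end E8

/-! ### Twisted subgroups and the double cover of `Alt₉`. -/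

namespace E8

theorem center_le_commutator : Subgroup.center weylE8 ≤ commutator weylE8 := fun z hz => by
  rcases isFrame_genBase.eq_one_or_negOne_of_mem_center hz with rfl | rfl
  exacts [one_mem _, mem_derived_iff.2 sgn_negOne]

theorem toOmega_surjective : Function.Surjective toOmega := QuotientGroup.mk'_surjective _

theorem toOmega_eq {x y : Derived} :
    toOmega x = toOmega y ↔ x.1⁻¹ * y.1 ∈ Subgroup.center weylE8 :=
  QuotientGroup.eq.trans Subgroup.mem_subgroupOf

section Twist

variable {τ : MulAut WeylE8Omega} {H K : Subgroup weylE8}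

theorem mem_twist {w : weylE8} :
    w ∈ twist τ H ↔ ∃ d : Derived, d.1 = w ∧ ∃ x : Derived, x.1 ∈ H ∧ τ (toOmega x) = toOmega d :=
  ⟨fun ⟨d, ⟨_, ⟨x, hx, hxy⟩, hyd⟩, hdw⟩ => ⟨d, hdw, x, hx, (congrArg τ hxy).trans hyd⟩,
    fun ⟨d, hdw, x, hx, hxd⟩ => ⟨d, ⟨_, ⟨x, hx, rfl⟩, hxd⟩, hdw⟩⟩

theorem twist_le : twist τ H ≤ commutator weylE8 := Subgroup.map_subtype_le _

theorem twist_mono (hHK : H ≤ K) : twist τ H ≤ twist τ K := fun w hw => by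
  obtain ⟨d, hd, x, hx, hxd⟩ := mem_twist.1 hw
  exact mem_twist.2 ⟨d, hd, x, hHK hx, hxd⟩

theorem center_le_twist : Subgroup.center weylE8 ≤ twist τ H := fun z hz =>
  mem_twist.2 ⟨⟨z, center_le_commutator hz⟩, rfl, 1, one_mem _, by
    rw [map_one, map_one, eq_comm, toOmega_eq_one]
    exact hz⟩

theorem twist_commutator : twist τ (commutator weylE8) = commutator weylE8 := by
  refine le_antisymm twist_le fun w hw => ?_
  obtain ⟨x, hx⟩ := toOmega_surjective (τ⁻¹ (toOmega ⟨w, hw⟩))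
  exact mem_twist.2 ⟨⟨w, hw⟩, rfl, x, x.2, by rw [hx, MulAut.apply_inv_self]⟩

theorem twist_inv_twist (hH : H ≤ commutator weylE8) :
    twist τ⁻¹ (twist τ H) = Subgroup.center weylE8 ⊔ H := by
  refine le_antisymm (fun w hw => ?_) (sup_le center_le_twist fun y hy => ?_)
  · obtain ⟨d, rfl, x, hx, hxd⟩ := mem_twist.1 hw
    obtain ⟨x', hxx', y, hy, hyx⟩ := mem_twist.1 hx
    obtain rfl := Subtype.ext hxx'
    rw [← hyx, MulAut.inv_apply_self, toOmega_eq] at hxd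
    rw [← mul_inv_cancel_left y.1 d.1]
    exact mul_mem (Subgroup.mem_sup_right hy) (Subgroup.mem_sup_left hxd)
  · obtain ⟨x, hx⟩ := toOmega_surjective (τ (toOmega ⟨y, hH hy⟩))
    exact mem_twist.2 ⟨⟨y, hH hy⟩, rfl, x, mem_twist.2 ⟨x, rfl, ⟨y, hH hy⟩, hy, hx.symm⟩, by
      rw [hx, MulAut.inv_apply_self]⟩

theorem twist_twist_inv (hH : H ≤ commutator weylE8) :
    twist τ (twist τ⁻¹ H) = Subgroup.center weylE8 ⊔ H := by
  simpa using twist_inv_twist (τ := τ⁻¹) hH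

/-- Twisting by `τ` and by `τ⁻¹` are inverse order isomorphisms on the subgroups between `Z(W)` and
`W'`. -/
theorem twist_covBy (hH : (Subgroup.center weylE8 ⊔ H) ⋖ commutator weylE8) :
    twist τ H ⋖ commutator weylE8 := by
  have hHW : H ≤ commutator weylE8 := le_sup_right.trans hH.le
  refine ⟨twist_le.lt_of_ne fun heq => ?_, fun M hHM hM => ?_⟩
  · rw [← twist_inv_twist (τ := τ) hHW, heq, twist_commutator] at hH
    exact hH.lt.ne rfl
  · have h1 : twist τ (twist τ⁻¹ M) = M :=
      (twist_twist_inv hM.le).trans (sup_eq_right.2 (center_le_twist.trans hHM.le))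
    rcases hH.eq_or_eq ((twist_inv_twist hHW).symm.le.trans (twist_mono hHM.le)) twist_le
      with h | h
    · rw [h, ← twist_inv_twist (τ := τ) hHW, twist_twist_inv twist_le,
        sup_eq_right.2 center_le_twist] at h1
      exact hHM.ne h1
    · rw [h, twist_commutator] at h1
      exact hM.ne h1.symm

end Twist

/-- `K` is a central extension of `Alt_n` by `⟨z⟩`. Its commutator subgroup maps onto the perfect
group `Alt_n` and contains `z = ⁅k, l⁆`, so `K` is perfect; its centre is the kernel because `Alt_n`
is centreless. -/
theorem isDoubleCoverAlt_of {K Ω : Type*} [Group K] [Group Ω] {n : ℕ} (hn : 5 ≤ n) (f : K →* Ω)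
    (g : alternatingGroup (Fin n) →* Ω) (hg : Function.Injective g) (hfg : f.range = g.range)
    {z : K} (hz : ∀ k, f k = 1 ↔ k = 1 ∨ k = z) (hz1 : z ≠ 1) (hzK : z ∈ Subgroup.center K)
    {k l : K} (hkl : k * l = z * (l * k)) : IsDoubleCoverAlt n K := by
  have hcenter : Subgroup.center K = f.ker := by
    ext x
    rw [MonoidHom.mem_ker]
    refine ⟨fun hx => ?_, fun hx => ?_⟩
    · obtain ⟨s, hs⟩ : f x ∈ g.range := hfg ▸ ⟨x, rfl⟩
      have : s ∈ Subgroup.center (alternatingGroup (Fin n)) := by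
        refine Subgroup.mem_center_iff.2 fun t => hg ?_
        obtain ⟨y, hy⟩ : g t ∈ f.range := hfg ▸ ⟨t, rfl⟩
        rw [map_mul, map_mul, hs, ← hy, ← map_mul, ← map_mul, Subgroup.mem_center_iff.1 hx]
      rw [alternatingGroup.center_eq_bot (by rw [Nat.card_fin]; omega), Subgroup.mem_bot] at this
      rw [← hs, this, map_one]
    · rcases (hz x).1 hx with rfl | rfl
      exacts [one_mem _, hzK]
  refine ⟨?_, ?_, ⟨?_⟩⟩
  · have hzc : z ∈ commutator K := by
      have : z = ⁅k, l⁆ := by rw [commutatorElement_def, hkl]; group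
      rw [this]
      exact Subgroup.commutator_mem_commutator (Subgroup.mem_top _) (Subgroup.mem_top _)
    have hmap : (commutator K).map f = f.range := by
      rw [commutator_def, Subgroup.map_commutator, ← MonoidHom.range_eq_map, hfg,
        MonoidHom.range_eq_map, ← Subgroup.map_commutator, ← commutator_def,
        commutator_alternatingGroup_eq_top (by rwa [Nat.card_fin])]
    refine eq_top_iff.2 fun x _ => ?_
    obtain ⟨c, hc, hcx⟩ : f x ∈ (commutator K).map f := hmap ▸ ⟨x, rfl⟩
    rw [← mul_inv_cancel_left c x]
    refine mul_mem hc ?_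
    rcases (hz (c⁻¹ * x)).1 (by rw [map_mul, map_inv, hcx, inv_mul_cancel]) with h | h <;> rw [h]
    exacts [one_mem _, hzc]
  · refine Nat.card_eq_two_iff.2 ⟨1, ⟨z, hzK⟩, fun h => hz1 (congrArg Subtype.val h).symm, ?_⟩
    refine Set.eq_univ_of_forall fun x => ?_
    rcases (hz x).1 (hcenter.le x.2) with h | h
    exacts [Or.inl (Subtype.ext h), Or.inr (Subtype.ext h)]
  · exact ((QuotientGroup.quotientMulEquivOfEq hcenter).trans
      (QuotientGroup.quotientKerEquivRange f)).trans
      ((MulEquiv.subgroupCongr hfg).trans (MonoidHom.ofInjective hg).symm)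

namespace IsFrame

variable {ε : Fin 9 → E8Space}

theorem exists_anticomm (h : IsFrame ε) {τ : MulAut WeylE8Omega}
    (hτ : ∀ p, τ (toOmegaFst p) = toOmegaFst (rotate p)) :
    ∃ x y k l : Derived, x.1 ∈ ⁅weylSub (diffs ε), weylSub (diffs ε)⁆ ∧
      y.1 ∈ ⁅weylSub (diffs ε), weylSub (diffs ε)⁆ ∧ x.1 * y.1 = y.1 * x.1 ∧
      τ (toOmega x) = toOmega k ∧ τ (toOmega y) = toOmega l ∧
      k.1 * l.1 = negOne * (l.1 * k.1) := by
  have h01 : (0 : Fin 9) ≠ 1 := by decide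
  have h23 : (2 : Fin 9) ≠ 3 := by decide
  have h02 : (0 : Fin 9) ≠ 2 := by decide
  have h13 : (1 : Fin 9) ≠ 3 := by decide
  obtain ⟨p, hp⟩ := exists_triple ⟨rf (h.root h01) * rf (h.root h23),
    mem_derived_iff.2 (by simp [sgn_rf])⟩
  obtain ⟨q, hq⟩ := exists_triple ⟨rf (h.root h02) * rf (h.root h13),
    mem_derived_iff.2 (by simp [sgn_rf])⟩
  refine ⟨p.1.1, q.1.1, p.1.2.1, q.1.2.1, ?_, ?_, ?_, hτ p, hτ q, ?_⟩
  · rw [hp]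
    exact h.rf_root_mul_mem _ _
  · rw [hq]
    exact h.rf_root_mul_mem _ _
  · rw [hp, hq]
    simp only [← h.permHom_swap, ← map_mul]
    exact congrArg _ (by decide)
  · refine triple_anticomm (a := h.root h01) (b := h.root h23) (c := h.root h02)
      (d := h.root h13) ?_ ?_ ?_ ?_ (congrArg Subtype.val hp) (congrArg Subtype.val hq)
    · simp [root, h.dot, dotProduct_sub, sub_dotProduct]
    · simp [root, h.dot, dotProduct_sub, sub_dotProduct]
    · simp [root, h.dot, dotProduct_sub, sub_dotProduct]
    · simp only [root]
      abel

/-- Conjugation by `w` would carry the commuting `x`, `y` to commuting elements that agree with `k`,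
`l` modulo the centre, but `k` and `l` do not commute. -/
theorem isTrialityType (h : IsFrame ε) {τ : MulAut WeylE8Omega}
    (hτ : ∀ p, τ (toOmegaFst p) = toOmegaFst (rotate p)) : IsTrialityType τ := by
  rintro ⟨w, hw⟩
  obtain ⟨x, y, k, l, -, -, hxy, hk, hl, hkl⟩ := h.exists_anticomm hτ
  rw [hw, toOmega_eq, MulAut.conjNormal_apply] at hk hl
  generalize hs : (w * x.1 * w⁻¹)⁻¹ * k.1 = s at hk
  generalize ht : (w * y.1 * w⁻¹)⁻¹ * l.1 = t at hl
  rw [inv_mul_eq_iff_eq_mul] at hs ht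
  have hcomm : k.1 * l.1 = l.1 * k.1 := by
    have h1 := Subgroup.mem_center_iff.1 hk
    have h2 := Subgroup.mem_center_iff.1 hl
    calc k.1 * l.1 = w * x.1 * w⁻¹ * (s * (w * y.1 * w⁻¹)) * t := by rw [hs, ht]; group
      _ = w * (x.1 * y.1) * w⁻¹ * (s * t) := by rw [← h1]; group
      _ = w * (y.1 * x.1) * w⁻¹ * (t * s) := by rw [hxy, h1]
      _ = w * y.1 * w⁻¹ * (w * x.1 * w⁻¹ * t) * s := by group
      _ = l.1 * k.1 := by rw [h2, hs, ht]; group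
  rw [hcomm, eq_comm, mul_eq_right] at hkl
  exact negOne_ne_one hkl

theorem isDoubleCoverAlt_twist (h : IsFrame ε) {τ : MulAut WeylE8Omega}
    (hτ : ∀ p, τ (toOmegaFst p) = toOmegaFst (rotate p)) :
    IsDoubleCoverAlt 9 (twist τ ⁅weylSub (diffs ε), weylSub (diffs ε)⁆) := by
  obtain ⟨x, y, k, l, hx, hy, -, hk, hl, hkl⟩ := h.exists_anticomm hτ
  let i : alternatingGroup (Fin 9) →* Derived :=
    (h.permHom.comp (alternatingGroup (Fin 9)).subtype).codRestrict _ fun s =>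
      mem_derived_iff.2 (h.sgn_permHom_eq_one.2 s.2)
  refine isDoubleCoverAlt_of (by norm_num) (toOmega.comp (Subgroup.inclusion twist_le))
    (τ.toMonoidHom.comp (toOmega.comp i)) ?_ ?_ (z := ⟨negOne, center_le_twist negOne_mem_center⟩)
    (fun w => ?_) (fun hz => negOne_ne_one (congrArg Subtype.val hz))
    (Subgroup.mem_center_iff.2 fun w => Subtype.ext
      (Subgroup.mem_center_iff.1 negOne_mem_center w.1))
    (k := ⟨k.1, mem_twist.2 ⟨k, rfl, x, hx, hk⟩⟩) (l := ⟨l.1, mem_twist.2 ⟨l, rfl, y, hy, hl⟩⟩)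
    (Subtype.ext hkl)
  · refine (injective_iff_map_eq_one _).2 fun s hs => ?_
    have h1 : toOmega (i s) = 1 := (map_eq_one_iff τ τ.injective).1 hs
    have h2 := Subgroup.disjoint_def.1 h.disjoint_center (toOmega_eq_one.1 h1)
      (h.weylSub_diffs ▸ ⟨s.1, rfl⟩)
    exact Subtype.ext (h.permHom_injective (h2.trans (map_one _).symm))
  · ext o
    constructor
    · rintro ⟨w, rfl⟩
      obtain ⟨d, hd, u, hu, hud⟩ := mem_twist.1 w.2
      rw [h.commutator_weylSub] at hu
      obtain ⟨s, hs, hsu⟩ := hu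
      refine ⟨⟨s, hs⟩, ?_⟩
      have : i ⟨s, hs⟩ = u := Subtype.ext hsu
      change τ (toOmega (i ⟨s, hs⟩)) = toOmega ⟨w.1, _⟩
      rw [this, hud]
      exact congrArg toOmega (Subtype.ext hd)
    · rintro ⟨s, rfl⟩
      obtain ⟨d, hd⟩ := toOmega_surjective (τ (toOmega (i s)))
      refine ⟨⟨d.1, mem_twist.2 ⟨d, rfl, i s, ?_, hd.symm⟩⟩, hd⟩
      rw [h.commutator_weylSub]
      exact ⟨s.1, s.2, rfl⟩
  · refine (toOmega_eq_one (d := Subgroup.inclusion twist_le w)).trans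
      (h.mem_center_iff.trans ?_)
    exact or_congr (Subtype.ext_iff (a1 := w) (a2 := 1)).symm
      (Subtype.ext_iff (a1 := w) (a2 := ⟨negOne, _⟩)).symm

end IsFrame

theorem orderOf_eq_three {τ : MulAut WeylE8Omega}
    (hτ : ∀ p, τ (toOmegaFst p) = toOmegaFst (rotate p)) (h : IsTrialityType τ) :
    orderOf τ = 3 := by
  refine orderOf_eq_prime (MulEquiv.ext fun x => ?_) fun h1 => h ⟨1, fun x => ?_⟩
  · obtain ⟨p, rfl⟩ := toOmegaFst_surjective x
    change τ (τ (τ (toOmegaFst p))) = toOmegaFst p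
    rw [hτ, hτ, hτ]
    rfl
  · rw [h1, map_one]
    rfl

end E8

theorem mainTheorem5 (Φ₀ : Set E8Space) (hΦ₀ : IsA8Subsystem Φ₀) :
    -- `W₀ ≅ Sym₉`, and the product of `Z(W)` and `W₀` is direct
    Nonempty (weylSub Φ₀ ≃* Equiv.Perm (Fin 9)) ∧
    Disjoint (Subgroup.center weylE8) (weylSub Φ₀) ∧
    -- (i) `Z(W) × W₀` is maximal in `W`
    IsCoatom (Subgroup.center weylE8 ⊔ weylSub Φ₀) ∧
    -- (ii) `Z(W) × W₀'` is maximal in `W'`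
    (Subgroup.center weylE8 ⊔ ⁅weylSub Φ₀, weylSub Φ₀⁆) ⋖ commutator weylE8 ∧
    -- the triality twist `2·Alt₉` of `Z(W) × W₀'` exists, and every such twist is maximal in `W'`
    (∃ τ : MulAut WeylE8Omega, orderOf τ = 3 ∧ IsTrialityType τ ∧
      IsDoubleCoverAlt 9 (twist τ ⁅weylSub Φ₀, weylSub Φ₀⁆)) ∧
    (∀ τ : MulAut WeylE8Omega, IsTrialityType τ →
      twist τ ⁅weylSub Φ₀, weylSub Φ₀⁆ ⋖ commutator weylE8) := by
  obtain ⟨ε, h, rfl⟩ := E8.exists_frame hΦ₀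
  obtain ⟨τ, hτ⟩ := E8.exists_triality
  exact ⟨⟨(MulEquiv.subgroupCongr h.weylSub_diffs).trans
      (MonoidHom.ofInjective h.permHom_injective).symm⟩,
    h.disjoint_center, h.isCoatom_sup, h.sup_covBy,
    ⟨τ, E8.orderOf_eq_three hτ (h.isTrialityType hτ), h.isTrialityType hτ,
      h.isDoubleCoverAlt_twist hτ⟩,
    fun _ _ => E8.twist_covBy h.sup_covBy⟩
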